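/- Let $M=\mathbb{CP}^1\times\mathbb{CP}^1$, and use the affine parametrizations $w\mapsto[1:w]$ and $z\mapsto[z:1]$ of $\mathbb{CP}^1$. In a product $\varphi=(\varphi_1,\varphi_2)$ of two of these, a horizontal flow box of a closed set $X\subset M$ is given by a point $(z_0,w_0)\in\mathbb C^2$, a disk $D=\{|z|<r\}$, a bounded set $A\subset\mathbb C$ with $0\in A$, and holomorphic functions $f_\alpha:D\to\mathbb C$ $(\alpha\in A)$ with $f_\alpha(0)=0$, such that $(\alpha,z)\mapsto\varphi(z_0+z,\,w_0+\alpha+f_\alpha(z))$ is a homeomorphism from $A\times D$ onto a relatively open subset of $X$; the images $\Gamma_\alpha$ of $\{\alpha\}\times D$ are its plaques. Vertical flow boxes are defined in the same way with the two coordinates exchanged. A lamination $(X,\mathcal L)$ by Riemann surfaces embedded in $M$ is a closed set $X\subset M$ with an atlas of horizontal or vertical flow boxes covering $X$ and compatible with each other, that is, the intersection of any two plaques is open in both; a flow box of $(X,\mathcal L)$ is one that is compatible with the atlas. The leaf through a point is the set of points that can be joined to it by a finite chain of plaques, and a minimal set is a minimal element among the nonempty closed unions of leaves. A point of $X$ is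 horizontal (vertical) if the tangent line of its leaf there is horizontal (vertical). The lamination is Lipschitz if $X$ can be covered by flow boxes in each of which there is $C>0$ with $|\alpha-\beta|/C\le|\alpha+f_\alpha(t)-\beta-f_\beta(t)|\le C|\alpha-\beta|$ for all $\alpha,\beta\in A$, $t\in D$. Theorem. Let $(X,\mathcal L)$ be a lamination embedded in $M=\mathbb{CP}^1\times\mathbb{CP}^1$ without compact leaves and with exactly one minimal set, and suppose that the minimal set contains a point $p$ (for instance $p=([0:1],[1:0])$ or $p=([1:0],[0:1])$) that is neither vertical nor horizontal. For $\epsilon\in\mathbb C$ let $\Phi_\epsilon([z_1:z_2],[w_1:w_2])=([z_1+\epsilon z_2:z_2],[w_1:w_2])$. Then there exist a covering of $X$ by flow boxes of $(X,\mathcal L)$ and constants $\epsilon_0>0$, $N\in\mathbb N$, $A>0$ such that, for every flow box of the covering, all plaques $\Gamma_\alpha,\Gamma_\beta$ of that flow box and all $\epsilon\in\mathbb C$ with $0<|\epsilon|<\epsilon_0$, with $\Gamma_\beta^\epsilon=\Phi_\epsilon(\Gamma_\beta)$: 1. if $(X,\mathcal L)$ is Lipschitz, then $\mathrm{Card}(\Gamma_\alpha\cap\Gamma_\beta^\epsilon)<N$;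 2. in general, $\mathrm{Card}(\Gamma_\alpha\cap\Gamma_\beta^\epsilon)<A\log(1/|\epsilon|)$. In particular these intersections are finite. -/

import Mathlib

open Topology Set
open scoped LinearAlgebra.Projectivization

/-- The complex projective line, with homogeneous coordinates `[v 0 : v 1]`. -/
abbrev CP1 : Type := ℙ ℂ (Fin 2 → ℂ)

/-- The quotient topology from `ℂ² \ {0}`. -/
instance CP1.instTopologicalSpace : TopologicalSpace CP1 :=
  inferInstanceAs (TopologicalSpace (Quotient (projectivizationSetoid ℂ (Fin 2 → ℂ))))

/-- The two standard affine parametrizations of the projective line: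
`φ₁ (w) = [1 : w]` for `i = 0` and `φ₂ (z) = [z : 1]` for `i = 1`. -/
noncomputable def affineChart (i : Fin 2) (z : ℂ) : CP1 :=
  if i = 0 then
    Projectivization.mk ℂ (![1, z] : Fin 2 → ℂ) (fun h => by simpa using congrFun h 0)
  else
    Projectivization.mk ℂ (![z, 1] : Fin 2 → ℂ) (fun h => by simpa using congrFun h 1)

/-- The linear map `(z₁, z₂) ↦ (z₁ + ε z₂, z₂)`. -/
noncomputable def shearLin (ε : ℂ) : (Fin 2 → ℂ) →ₗ[ℂ] (Fin 2 → ℂ) where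
  toFun v := ![v 0 + ε * v 1, v 1]
  map_add' v w := by
    ext i; fin_cases i <;> simp
    ring
  map_smul' c v := by
    ext i; fin_cases i <;> simp
    ring

theorem shearLin_injective (ε : ℂ) : Function.Injective (shearLin ε) := by
  intro v w h
  have h0 := congrFun h 0
  have h1 := congrFun h 1
  simp [shearLin] at h0 h1
  rw [h1] at h0
  ext i; fin_cases i
  · simpa using h0
  · simpa using h1

/-- The automorphism `Φ_ε ([z₁ : z₂], [w₁ : w₂]) = ([z₁ + ε z₂ : z₂], [w₁ : w₂])`. -/
noncomputable def Phi (ε : ℂ) (p : CP1 × CP1) : CP1 × CP1 :=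
  (Projectivization.map (shearLin ε) (shearLin_injective ε) p.1, p.2)

/-- A family of pairwise distinct graphs of holomorphic functions over a disk, written in a product
of two affine parametrizations. If `vertical = false`, the graph with index `α` is the image of
`z ↦ (z₀ + z, w₀ + α + f_α (z))`; if `vertical = true`, it is the image of
`w ↦ (z₀ + α + f_α (w), w₀ + w)`. -/
structure FlowBox where
  /-- `false`: graphs over the first coordinate; `true`: graphs over the second coordinate. -/
  vertical : Bool
  /-- the affine parametrization used in the first factor -/
  chart₁ : Fin 2
  /-- the affine parametrization used in the second factor -/
  chart₂ : Fin 2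
  z₀ : ℂ
  w₀ : ℂ
  /-- the radius of the disk over which the plaques are graphs -/
  radius : ℝ
  radius_pos : 0 < radius
  /-- the transversal -/
  trans : Set ℂ
  trans_bounded : Bornology.IsBounded trans
  zero_mem_trans : (0 : ℂ) ∈ trans
  f : ℂ → ℂ → ℂ
  f_holo : ∀ α ∈ trans, DifferentiableOn ℂ (f α) (Metric.ball 0 radius)
  f_zero : ∀ α ∈ trans, f α 0 = 0

namespace FlowBox

/-- The point with parameter `t` on the plaque with index `α`. -/
noncomputable def pt (B : FlowBox) (α t : ℂ) : CP1 × CP1 :=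
  if B.vertical then
    (affineChart B.chart₁ (B.z₀ + α + B.f α t), affineChart B.chart₂ (B.w₀ + t))
  else
    (affineChart B.chart₁ (B.z₀ + t), affineChart B.chart₂ (B.w₀ + α + B.f α t))

/-- The plaque with index `α`. -/
def plaque (B : FlowBox) (α : ℂ) : Set (CP1 × CP1) :=
  B.pt α '' Metric.ball 0 B.radius

/-- The union of the plaques. -/
def support (B : FlowBox) : Set (CP1 × CP1) :=
  ⋃ α ∈ B.trans, B.plaque α

/-- The product of the transversal and the disk is mapped homeomorphically onto a relatively open
subset of `X`. -/
def IsChartOf (B : FlowBox) (X : Set (CP1 × CP1)) : Prop :=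
  IsEmbedding (fun q : B.trans × Metric.ball (0 : ℂ) B.radius => B.pt q.1 q.2) ∧
    ∃ O : Set (CP1 × CP1), IsOpen O ∧ B.support = O ∩ X

/-- Two plaques that meet at a point coincide near that point (so that the intersection of a
plaque of `B` and a plaque of `B'` is open in both). -/
def Compatible (B B' : FlowBox) : Prop :=
  ∀ α ∈ B.trans, ∀ β ∈ B'.trans, ∀ x ∈ B.plaque α ∩ B'.plaque β,
    ∀ᶠ y in 𝓝 x, (y ∈ B.plaque α ↔ y ∈ B'.plaque β)

/-- The transversal distances between plaques are uniformly comparable with the distances of their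
indices. -/
def IsLipschitz (B : FlowBox) : Prop :=
  ∃ C : ℝ, 0 < C ∧ ∀ α ∈ B.trans, ∀ β ∈ B.trans, ∀ t ∈ Metric.ball (0 : ℂ) B.radius,
    ‖α - β‖ / C ≤ ‖(α + B.f α t) - (β + B.f β t)‖ ∧
      ‖(α + B.f α t) - (β + B.f β t)‖ ≤ C * ‖α - β‖

/-- Some plaque of `B` passes through `p` with tangent line in the direction of the disk
coordinate: horizontal if `B` is horizontal, vertical if `B` is vertical. -/
def IsFlatAt (B : FlowBox) (p : CP1 × CP1) : Prop :=
  ∃ α ∈ B.trans, ∃ t ∈ Metric.ball (0 : ℂ) B.radius, B.pt α t = p ∧ deriv (B.f α) t = 0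

end FlowBox

/-- A lamination by Riemann surfaces holomorphically embedded in the product of two projective
lines: a closed (hence compact) set with an atlas of compatible flow boxes. -/
structure Lamination where
  carrier : Set (CP1 × CP1)
  isClosed_carrier : IsClosed carrier
  atlas : Set FlowBox
  isChart : ∀ B ∈ atlas, B.IsChartOf carrier
  cover : carrier ⊆ ⋃ B ∈ atlas, B.support
  compatible : ∀ B ∈ atlas, ∀ B' ∈ atlas, B.Compatible B'

namespace Lamination

/-- `B` is a flow box of the lamination (a member of its maximal atlas). -/
def IsFlowBox (L : Lamination) (B : FlowBox) : Prop :=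
  B.IsChartOf L.carrier ∧ ∀ B' ∈ L.atlas, B.Compatible B'

/-- The two points lie on a common plaque. -/
def SamePlaque (L : Lamination) (p q : CP1 × CP1) : Prop :=
  ∃ B ∈ L.atlas, ∃ α ∈ B.trans, p ∈ B.plaque α ∧ q ∈ B.plaque α

/-- The leaf through `p`: the points that can be reached from `p` by a chain of plaques. -/
def leaf (L : Lamination) (p : CP1 × CP1) : Set (CP1 × CP1) :=
  {q | Relation.ReflTransGen L.SamePlaque p q}

def HasNoCompactLeaves (L : Lamination) : Prop :=
  ∀ p ∈ L.carrier, ¬ IsCompact (L.leaf p)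

/-- Nonempty closed unions of leaves. -/
def IsInvariantClosed (L : Lamination) (Y : Set (CP1 × CP1)) : Prop :=
  Y.Nonempty ∧ IsClosed Y ∧ Y ⊆ L.carrier ∧ ∀ p ∈ Y, L.leaf p ⊆ Y

/-- Minimal sets: minimal elements among the nonempty closed unions of leaves. -/
def IsMinimalSet (L : Lamination) (Y : Set (CP1 × CP1)) : Prop :=
  L.IsInvariantClosed Y ∧ ∀ Z, L.IsInvariantClosed Z → Z ⊆ Y → Z = Y

/-- The tangent line of the lamination at `p` is horizontal. -/
def IsHorizontalPoint (L : Lamination) (p : CP1 × CP1) : Prop :=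
  ∃ B, L.IsFlowBox B ∧ B.vertical = false ∧ B.IsFlatAt p

/-- The tangent line of the lamination at `p` is vertical. -/
def IsVerticalPoint (L : Lamination) (p : CP1 × CP1) : Prop :=
  ∃ B, L.IsFlowBox B ∧ B.vertical = true ∧ B.IsFlatAt p

/-- A (transversally) Lipschitz lamination: it can be covered by Lipschitz flow boxes. -/
def IsLipschitz (L : Lamination) : Prop :=
  ∀ p ∈ L.carrier, ∃ B, L.IsFlowBox B ∧ p ∈ B.support ∧ B.IsLipschitz

end Lamination

/-! Within one flow box, the image of a plaque under `Phi ε` is again a graph over (almost) the same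
disk. Its intersections with another plaque are therefore zeros of a holomorphic function of one
variable, `FlowBox.gap`. A bounded holomorphic function with n zeros in a smaller disk has size at
most a constant times c^n there, with c < 1 (Blaschke factors). So it suffices to bound the gap from
below at some point, by a power of |ε|.

The lower bound originates over the point at infinity of the first factor, a fixed point of the
shear. In the coordinate z = 1/ζ the shear is z/(1+εz) = z - εz² + ..., so it moves points by about
ε away from z = 0 and not at all at z = 0. If the gap were much smaller than |ε| near such a point,
the difference of the two unsheared plaques would have size at least about |ε| on a circle and be
much smaller at its center. But distinct plaques are disjoint, so this difference has no zeros and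
the minimum principle forbids that. Hence the gap is at least σ|ε| somewhere nearby.

Every leaf passes over infinity. A leaf contained in a fibre of a projection would be compact; hence
the closure of a leaf projects onto an open and closed set, and Hurwitz's argument brings the leaf
itself to the fibre (`exists_mem_leaf_fst_eq`).

The bound then travels along leaves. By a three circles inequality, a gap that is tiny near one
point of a plaque is tiny near any other one. Contrapositively, a lower bound σ|ε|^κ passes on with
a larger κ. In the Lipschitz case a gap at most |ε| at one point is O(|ε|) on the whole disk, so
after division by ε the function is bounded and the exponent stays 1. This produces the separation
at all points (`HasNoCompactLeaves.isSeparatedAt`).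

Comparing σ|ε|^κ ≤ M|ε|^e c^n, with e = κ = 1 in the Lipschitz case and e = 0 otherwise, bounds n by
a constant or by a multiple of log(1/|ε|). Compactness makes the constants uniform. -/

/-! ### Topology and affine charts of the projective line. -/

/-- The representative of `affineChart i z`: its `i`-th coordinate is `1`, the other one is `z`. -/
def affineVec (i : Fin 2) (z : ℂ) : Fin 2 → ℂ := fun j => if j = i then 1 else z

theorem affineVec_ne_zero (i : Fin 2) (z : ℂ) : affineVec i z ≠ 0 := fun h => by
  simpa [affineVec] using congrFun h i

theorem affineChart_eq_mk (i : Fin 2) (z : ℂ) :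
    affineChart i z = Projectivization.mk ℂ (affineVec i z) (affineVec_ne_zero i z) := by
  have h : ∀ j : Fin 2, affineVec j z = if j = 0 then ![1, z] else ![z, 1] := by
    intro j
    fin_cases j <;> ext k <;> fin_cases k <;> simp [affineVec]
  unfold affineChart
  split_ifs with hi
  · simp [h, hi]
  · simp [h, hi]

theorem isQuotientMap_mk' :
    IsQuotientMap (Projectivization.mk' ℂ : {v : Fin 2 → ℂ // v ≠ 0} → CP1) :=
  isQuotientMap_quot_mk

theorem affineVec_other {i j : Fin 2} (h : j ≠ i) (z : ℂ) : affineVec i z j = z := by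
  simp [affineVec, h]

theorem affineVec_self (i : Fin 2) (z : ℂ) : affineVec i z i = 1 := by
  simp [affineVec]

theorem Fin.one_sub_ne (i : Fin 2) : 1 - i ≠ i := by
  fin_cases i <;> simp

theorem Fin.eq_or_eq_one_sub (i j : Fin 2) : j = i ∨ j = 1 - i := by
  fin_cases i <;> fin_cases j <;> simp

theorem mk_eq_affineChart_iff (i : Fin 2) (v : Fin 2 → ℂ) (hv : v ≠ 0) (z : ℂ) :
    Projectivization.mk ℂ v hv = affineChart i z ↔ v i ≠ 0 ∧ v (1 - i) / v i = z := by
  rw [affineChart_eq_mk, Projectivization.mk_eq_mk_iff']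
  constructor
  · rintro ⟨a, rfl⟩
    have ha : a ≠ 0 := by rintro rfl; simp at hv
    simp [affineVec_self, affineVec_other (Fin.one_sub_ne i), ha]
  · rintro ⟨h0, rfl⟩
    refine ⟨v i, ?_⟩
    ext j
    rcases Fin.eq_or_eq_one_sub i j with rfl | rfl
    · simp [affineVec_self]
    · simp [affineVec_other (Fin.one_sub_ne i)]
      field_simp

theorem affineChart_injective (i : Fin 2) : Function.Injective (affineChart i) := by
  intro z w h
  rw [affineChart_eq_mk, mk_eq_affineChart_iff] at h
  simpa [affineVec_self, affineVec_other (Fin.one_sub_ne i)] using h.2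

theorem continuous_affineChart (i : Fin 2) : Continuous (affineChart i) := by
  have h : affineChart i = Projectivization.mk' ℂ ∘ fun z => ⟨affineVec i z, affineVec_ne_zero i z⟩ := by
    funext z
    simp [affineChart_eq_mk]
  rw [h]
  refine isQuotientMap_mk'.continuous.comp (Continuous.subtype_mk ?_ _)
  refine continuous_pi fun j => ?_
  unfold affineVec
  split_ifs <;> fun_prop

theorem isOpenMap_affineChart (i : Fin 2) : IsOpenMap (affineChart i) := by
  intro U hU
  rw [← isQuotientMap_mk'.isOpen_preimage]
  have h : Projectivization.mk' ℂ ⁻¹' (affineChart i '' U) =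
      {v : {v : Fin 2 → ℂ // v ≠ 0} | v.1 i ≠ 0} ∩
        (fun v : {v : Fin 2 → ℂ // v ≠ 0} => v.1 (1 - i) / v.1 i) ⁻¹' U := by
    ext ⟨v, hv⟩
    simp only [Projectivization.mk'_eq_mk, mem_preimage, mem_image, mem_inter_iff, mem_ofPred_eq]
    constructor
    · rintro ⟨z, hz, hzv⟩
      obtain ⟨h0, h1⟩ := (mk_eq_affineChart_iff i v hv z).1 hzv.symm
      exact ⟨h0, h1 ▸ hz⟩
    · rintro ⟨h0, h1⟩
      exact ⟨_, h1, ((mk_eq_affineChart_iff i v hv _).2 ⟨h0, rfl⟩).symm⟩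
  rw [h]
  have hc : ∀ j : Fin 2, Continuous fun v : {v : Fin 2 → ℂ // v ≠ 0} => v.1 j := fun j =>
    (continuous_apply j).comp continuous_subtype_val
  refine ContinuousOn.isOpen_inter_preimage ?_ (isOpen_ne_fun (hc i) continuous_const) hU
  exact (hc _).continuousOn.div (hc _).continuousOn fun v hv => hv

theorem isOpenEmbedding_affineChart (i : Fin 2) : IsOpenEmbedding (affineChart i) :=
  .of_continuous_injective_isOpenMap (continuous_affineChart i) (affineChart_injective i)
    (isOpenMap_affineChart i)

theorem exists_affineChart_norm_le (p : CP1) : ∃ i z, ‖z‖ ≤ 1 ∧ affineChart i z = p := by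
  induction p using Projectivization.ind with
  | h v hv =>
    have key : ∀ i : Fin 2, ‖v (1 - i)‖ ≤ ‖v i‖ →
        ∃ i z, ‖z‖ ≤ 1 ∧ affineChart i z = Projectivization.mk ℂ v hv := by
      intro i hi
      have h0 : v i ≠ 0 := by
        intro h0
        apply hv
        ext j
        rcases Fin.eq_or_eq_one_sub i j with rfl | rfl
        · simp [h0]
        · simpa [h0] using hi
      refine ⟨i, v (1 - i) / v i, ?_, ((mk_eq_affineChart_iff i v hv _).2 ⟨h0, rfl⟩).symm⟩
      rw [norm_div]
      exact div_le_one_of_le₀ hi (norm_nonneg _)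
    rcases le_total ‖v 0‖ ‖v 1‖ with h | h
    · exact key 1 (by simpa using h)
    · exact key 0 (by simpa using h)

instance CP1.instCompactSpace : CompactSpace CP1 := by
  refine ⟨?_⟩
  have h : (univ : Set CP1) = ⋃ i, affineChart i '' Metric.closedBall 0 1 := by
    ext p
    obtain ⟨i, z, hz, rfl⟩ := exists_affineChart_norm_le p
    simp only [mem_univ, mem_iUnion, true_iff]
    exact ⟨i, z, by simpa using hz, rfl⟩
  rw [h]
  exact isCompact_iUnion fun i => (isCompact_closedBall _ _).image (continuous_affineChart i)

theorem affineChart_one_one (i : Fin 2) : affineChart i 1 = affineChart 0 1 := by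
  rw [affineChart_eq_mk, mk_eq_affineChart_iff]
  fin_cases i <;> simp [affineVec]

instance CP1.instPreconnectedSpace : PreconnectedSpace CP1 := by
  refine ⟨?_⟩
  have h : (univ : Set CP1) = ⋃ i, range (affineChart i) := by
    ext p
    obtain ⟨i, z, hz, rfl⟩ := exists_affineChart_norm_le p
    simp
  rw [h]
  refine isPreconnected_iUnion ⟨affineChart 0 1, ?_⟩ fun i =>
    isPreconnected_range (continuous_affineChart i)
  simp only [mem_iInter]
  exact fun i => ⟨1, affineChart_one_one i⟩

/-- The point [1:0] is fixed by all shears; only the first parametrization sees it, at its center.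
-/
theorem affineChart_eq_infinity_iff (i : Fin 2) (z : ℂ) :
    affineChart i z = affineChart 0 0 ↔ i = 0 ∧ z = 0 := by
  rw [affineChart_eq_mk, mk_eq_affineChart_iff]
  fin_cases i <;> simp [affineVec]

/-! ### The shear and the chordal distance in affine coordinates. -/

/-- The map `[z₁ : z₂] ↦ [z₁ + ε z₂ : z₂]` in the affine parametrization `i`. -/
noncomputable def shearCoord (i : Fin 2) (ε z : ℂ) : ℂ :=
  if i = 0 then z / (1 + ε * z) else z + ε

theorem map_shearLin_affineChart (i : Fin 2) (ε z : ℂ) (h : 1 + ε * z ≠ 0) :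
    Projectivization.map (shearLin ε) (shearLin_injective ε) (affineChart i z) =
      affineChart i (shearCoord i ε z) := by
  rw [affineChart_eq_mk, Projectivization.map_mk, mk_eq_affineChart_iff]
  fin_cases i
  · simp [affineVec, shearLin, shearCoord, h]
  · simp [affineVec, shearLin, shearCoord]

/-- The chordal distance of two points of the projective line (with respect to the supremum norm of
`ℂ²`). -/
noncomputable def chord (p q : CP1) : ℝ :=
  ‖p.rep 0 * q.rep 1 - p.rep 1 * q.rep 0‖ / (‖p.rep‖ * ‖q.rep‖)

/-- The determinant and the product of norms scale by the same factor, so any representatives may be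
used. -/
theorem chord_mk (v w : Fin 2 → ℂ) (hv : v ≠ 0) (hw : w ≠ 0) :
    chord (Projectivization.mk ℂ v hv) (Projectivization.mk ℂ w hw) =
      ‖v 0 * w 1 - v 1 * w 0‖ / (‖v‖ * ‖w‖) := by
  obtain ⟨a, ha⟩ := Projectivization.exists_smul_eq_mk_rep ℂ v hv
  obtain ⟨b, hb⟩ := Projectivization.exists_smul_eq_mk_rep ℂ w hw
  unfold chord
  rw [← ha, ← hb]
  have ha0 : ‖(a : ℂ)‖ ≠ 0 := by simp
  have hb0 : ‖(b : ℂ)‖ ≠ 0 := by simp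
  simp only [Units.smul_def, Pi.smul_apply, smul_eq_mul, norm_smul]
  rw [show (a : ℂ) * v 0 * (b * w 1) - a * v 1 * (b * w 0) = a * b * (v 0 * w 1 - v 1 * w 0) by ring,
    norm_mul, norm_mul]
  rw [show ‖(a : ℂ)‖ * ‖v‖ * (‖(b : ℂ)‖ * ‖w‖) = ‖(a : ℂ)‖ * ‖(b : ℂ)‖ * (‖v‖ * ‖w‖) by ring]
  exact mul_div_mul_left _ _ (mul_ne_zero ha0 hb0)

theorem norm_affineVec (i : Fin 2) (z : ℂ) : ‖affineVec i z‖ = max 1 ‖z‖ := by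
  refine le_antisymm ?_ (max_le ?_ ?_)
  · refine (pi_norm_le_iff_of_nonneg (by positivity)).2 fun j => ?_
    unfold affineVec
    split_ifs <;> simp
  · simpa [affineVec_self] using norm_le_pi_norm (affineVec i z) i
  · simpa [affineVec_other (Fin.one_sub_ne i)] using norm_le_pi_norm (affineVec i z) (1 - i)

theorem chord_affineChart (i : Fin 2) (z w : ℂ) :
    chord (affineChart i z) (affineChart i w) = ‖z - w‖ / (max 1 ‖z‖ * max 1 ‖w‖) := by
  rw [affineChart_eq_mk, affineChart_eq_mk, chord_mk, norm_affineVec, norm_affineVec]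
  congr 1
  fin_cases i
  · simp [affineVec, norm_sub_rev]
  · simp [affineVec]

theorem chord_nonneg (p q : CP1) : 0 ≤ chord p q := by
  unfold chord; positivity

theorem chord_affineChart_le (i : Fin 2) (z w : ℂ) :
    chord (affineChart i z) (affineChart i w) ≤ ‖z - w‖ := by
  rw [chord_affineChart]
  refine div_le_self (norm_nonneg _) ?_
  exact one_le_mul_of_one_le_of_one_le (le_max_left _ _) (le_max_left _ _)

theorem norm_sub_le_chord (i : Fin 2) {K : ℝ} (hK : 1 ≤ K) {z w : ℂ} (hz : ‖z‖ ≤ K) (hw : ‖w‖ ≤ K) :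
    ‖z - w‖ ≤ K ^ 2 * chord (affineChart i z) (affineChart i w) := by
  rw [chord_affineChart, mul_div_assoc', le_div_iff₀ (by positivity), mul_comm]
  gcongr
  rw [sq]
  gcongr <;> simp [*]

theorem chord_self (p : CP1) : chord p p = 0 := by
  simp [chord, mul_comm]

/-- The sum of the chordal distances of the two components. -/
noncomputable def chordSum (p q : CP1 × CP1) : ℝ := chord p.1 q.1 + chord p.2 q.2

theorem chordSum_self (p : CP1 × CP1) : chordSum p p = 0 := by
  simp [chordSum, chord_self]

theorem chordSum_nonneg (p q : CP1 × CP1) : 0 ≤ chordSum p q :=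
  add_nonneg (chord_nonneg _ _) (chord_nonneg _ _)

/-! ### Three circles inequality and propagation of smallness. -/

/-- A weak form of the three circles theorem. -/
theorem norm_sq_le_of_norm_sq_lt {h : ℂ → ℂ} {ρ R m M : ℝ}
    (hR : 0 < R) (hd : DifferentiableOn ℂ h (Metric.ball 0 R))
    (hm : ∀ t ∈ Metric.ball (0 : ℂ) R, ‖t‖ < ρ → ‖h t‖ ≤ m)
    (hM : ∀ t ∈ Metric.ball (0 : ℂ) R, ‖h t‖ ≤ M) {t : ℂ} (htR : ‖t‖ < R) (ht : ‖t‖ ^ 2 < ρ * R) :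
    ‖h t‖ ^ 2 ≤ m * M := by
  rcases lt_or_ge ‖t‖ ρ with hlt | hge
  · rw [sq]
    have h1 := hm t (by simpa using htR) hlt
    have h2 := hM t (by simpa using htR)
    exact mul_le_mul h1 h2 (norm_nonneg _) ((norm_nonneg _).trans h1)
  have hρ : 0 < ρ := by
    by_contra hρ
    nlinarith [sq_nonneg ‖t‖]
  have ht0 : 0 < ‖t‖ := hρ.trans_le hge
  -- With |t|²/R < ρ' < ρ, the annulus between ρ' and R' = |t|²/ρ' contains t, its closure lies in
  -- the disk of radius R, and τ ↦ t²/τ exchanges its two boundary circles.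
  obtain ⟨ρ', h1, h2⟩ := exists_between ((div_lt_iff₀ hR).2 ht)
  have hρ' : 0 < ρ' := lt_of_le_of_lt (by positivity) h1
  have h3 : ‖t‖ ^ 2 / ρ' < R := by
    rw [div_lt_iff₀ hρ', mul_comm]; rwa [div_lt_iff₀ hR] at h1
  set R' := ‖t‖ ^ 2 / ρ' with hR'
  have htR' : ‖t‖ < R' := by
    rw [hR', lt_div_iff₀ hρ', sq]; gcongr; linarith
  set U : Set ℂ := {τ | ρ' < ‖τ‖ ∧ ‖τ‖ < R'} with hU
  have hUo : IsOpen U :=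
    (isOpen_lt continuous_const continuous_norm).inter (isOpen_lt continuous_norm continuous_const)
  have hUc : closure U ⊆ {τ | ρ' ≤ ‖τ‖ ∧ ‖τ‖ ≤ R'} :=
    closure_minimal (fun τ hτ => ⟨hτ.1.le, hτ.2.le⟩)
      ((isClosed_le continuous_const continuous_norm).inter
        (isClosed_le continuous_norm continuous_const))
  have hinv : ∀ τ : ℂ, ρ' ≤ ‖τ‖ → ‖t ^ 2 / τ‖ < R := by
    intro τ hτ
    rw [norm_div, norm_pow]
    exact lt_of_le_of_lt (div_le_div_of_nonneg_left (by positivity) hρ' hτ) h3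
  have hdiff : DifferentiableOn ℂ (fun τ => h τ * h (t ^ 2 / τ)) (closure U) := by
    intro τ hτ
    obtain ⟨h4, h5⟩ := hUc hτ
    have hτ0 : τ ≠ 0 := by
      rintro rfl; simp at h4; linarith
    have e1 : DifferentiableAt ℂ h τ :=
      hd.differentiableAt (Metric.isOpen_ball.mem_nhds (by simpa using h5.trans_lt h3))
    have e2 : DifferentiableAt ℂ h (t ^ 2 / τ) :=
      hd.differentiableAt (Metric.isOpen_ball.mem_nhds (by simpa using hinv τ h4))
    have e3 : DifferentiableAt ℂ (fun τ : ℂ => t ^ 2 / τ) τ :=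
      (differentiableAt_const _).div differentiableAt_id hτ0
    exact (e1.mul (e2.comp τ e3)).differentiableWithinAt
  -- On either boundary circle one of τ, t²/τ has modulus ρ' < ρ, so one factor is at most m and the
  -- other at most M. At τ = t the product is h(t)².
  have hfr : ∀ τ ∈ frontier U, ‖(fun τ => h τ * h (t ^ 2 / τ)) τ‖ ≤ m * M := by
    intro τ hτ
    rw [hUo.frontier_eq] at hτ
    obtain ⟨h4, h5⟩ := hUc hτ.1
    have h6 : ‖τ‖ = ρ' ∨ ‖τ‖ = R' := by
      by_contra! hne
      exact hτ.2 ⟨lt_of_le_of_ne h4 (Ne.symm hne.1), lt_of_le_of_ne h5 hne.2⟩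
    have hτR := h5.trans_lt h3
    have h7 := hM τ (by simpa using hτR)
    have h8 := hM (t ^ 2 / τ) (by simpa using hinv τ h4)
    rw [norm_mul]
    rcases h6 with h6 | h6
    · have h9 := hm τ (by simpa using hτR) (by linarith)
      exact mul_le_mul h9 h8 (norm_nonneg _) ((norm_nonneg _).trans h9)
    · have h9 := hm (t ^ 2 / τ) (by simpa using hinv τ h4) (by
        rw [norm_div, norm_pow, h6, hR', div_div_cancel₀ (by positivity)]; exact h2)
      rw [mul_comm]
      exact mul_le_mul h9 h7 (norm_nonneg _) ((norm_nonneg _).trans h9)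
  have hbd : Bornology.IsBounded U :=
    (Metric.isBounded_ball (x := (0 : ℂ)) (r := R')).subset fun τ hτ => by simpa using hτ.2
  have := Complex.norm_le_of_forall_mem_frontier_norm_le hbd hdiff.diffContOnCl hfr
    (subset_closure (show t ∈ U from ⟨h2.trans_le hge, htR'⟩))
  have htt : t ^ 2 / t = t := by
    rw [sq, mul_div_assoc, div_self (norm_pos_iff.1 ht0), mul_one]
  simpa [htt, sq] using this

theorem norm_pow_two_pow_le {h : ℂ → ℂ} {R M : ℝ}
    (hR : 0 < R) (hd : DifferentiableOn ℂ h (Metric.ball 0 R))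
    (hM : ∀ t ∈ Metric.ball (0 : ℂ) R, ‖h t‖ ≤ M) (n : ℕ) :
    ∀ {ρ m : ℝ}, 0 < ρ → (∀ t ∈ Metric.ball (0 : ℂ) R, ‖t‖ < ρ → ‖h t‖ ≤ m) →
      ∀ t : ℂ, ‖t‖ < R → (‖t‖ / R) ^ (2 ^ n) < ρ / R → ‖h t‖ ^ (2 ^ n) ≤ m * M ^ (2 ^ n - 1) := by
  have hM0 : 0 ≤ M := (norm_nonneg _).trans (hM 0 (by simpa using hR))
  induction n with
  | zero =>
    intro ρ m hρ hm t ht ht2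
    have : ‖t‖ < ρ := by simpa [div_lt_div_iff_of_pos_right hR] using ht2
    simpa using hm t (by simpa using ht) this
  | succ n ih =>
    intro ρ m hρ hm t ht ht2
    have hm0 : 0 ≤ m := (norm_nonneg _).trans (hm 0 (by simpa using hR) (by simpa using hρ))
    -- The three circles step enlarges the radius of smallness from ρ to √(ρR) at the price of
    -- replacing m by √(mM).
    have key := ih (ρ := √(ρ * R)) (m := √(m * M)) (by positivity) (fun τ hτ hlt => by
      refine Real.le_sqrt_of_sq_le ?_
      have : ‖τ‖ ^ 2 < ρ * R := by
        rwa [← Real.lt_sqrt (norm_nonneg _)]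
      exact norm_sq_le_of_norm_sq_lt hR hd hm hM (by simpa using hτ) this) t ht (by
        rw [lt_div_iff₀ hR]
        refine Real.lt_sqrt_of_sq_lt ?_
        rw [mul_pow, ← pow_mul, ← pow_succ]
        calc (‖t‖ / R) ^ 2 ^ (n + 1) * R ^ 2 < ρ / R * R ^ 2 := by gcongr
          _ = ρ * R := by field_simp)
    have h2 : (‖h t‖ ^ 2 ^ n) ^ 2 ≤ (√(m * M) * M ^ (2 ^ n - 1)) ^ 2 := by gcongr
    rw [mul_pow, Real.sq_sqrt (by positivity), ← pow_mul, ← pow_mul, ← pow_succ] at h2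
    refine h2.trans_eq ?_
    rw [mul_assoc, ← pow_succ']
    congr 2
    have := Nat.one_le_two_pow (n := n)
    rw [pow_succ]; omega

/-- Holomorphic functions on the disk of radius `r` that are small near `x` are small near `y`. -/
def SmallnessPropagates (r : ℝ) (x y : ℂ) : Prop :=
  ∀ ρ > 0, ∃ ρ' > 0, ∃ N : ℕ, 1 ≤ N ∧ ∀ (h : ℂ → ℂ) (M m : ℝ),
    DifferentiableOn ℂ h (Metric.ball 0 r) → (∀ t ∈ Metric.ball (0 : ℂ) r, ‖h t‖ ≤ M) →
    (∀ t ∈ Metric.ball (0 : ℂ) r, t ∈ Metric.ball x ρ → ‖h t‖ ≤ m) →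
    ∀ t ∈ Metric.ball (0 : ℂ) r, t ∈ Metric.ball y ρ' → ‖h t‖ ^ N ≤ m * M ^ (N - 1)

theorem smallnessPropagates_of_ball_subset {r R : ℝ} {x y : ℂ}
    (hsub : Metric.ball x R ⊆ Metric.ball 0 r) (hy : y ∈ Metric.ball x R) :
    SmallnessPropagates r x y := by
  intro ρ hρ
  rw [Metric.mem_ball] at hy
  have hR : 0 < R := dist_nonneg.trans_lt hy
  obtain ⟨R', h1, h2⟩ := exists_between hy
  have hR' : 0 < R' := dist_nonneg.trans_lt h1
  -- All points within R' of x must be reached, which takes (R'/R)^(2^n) < ρ/R; the bound with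
  -- exponent n is stronger than needed.
  obtain ⟨n, hn⟩ := exists_pow_lt_of_lt_one (div_pos hρ hR) ((div_lt_one hR).2 h2)
  refine ⟨R' - dist y x, by linarith, 2 ^ n, Nat.one_le_two_pow, ?_⟩
  intro h M m hd hM hm t htr hty
  rw [Metric.mem_ball] at hty
  have htx : ‖t - x‖ < R' := by
    rw [← dist_eq_norm]
    linarith [dist_triangle t y x]
  have hmaps : ∀ s ∈ Metric.ball (0 : ℂ) R, x + s ∈ Metric.ball 0 r := fun s hs =>
    hsub (by simpa using hs)
  have := norm_pow_two_pow_le (h := fun s => h (x + s)) hR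
    (hd.comp (by fun_prop) hmaps) (fun s hs => hM _ (hmaps s hs)) n hρ
    (fun s hs hlt => hm _ (hmaps s hs) (by simpa using hlt)) (t - x) (htx.trans h2) (by
      refine lt_of_le_of_lt ?_ hn
      calc (‖t - x‖ / R) ^ 2 ^ n ≤ (R' / R) ^ 2 ^ n := by gcongr
        _ ≤ (R' / R) ^ n :=
          pow_le_pow_of_le_one (by positivity) ((div_lt_one hR).2 h2).le n.lt_two_pow_self.le)
  simpa using this

/-- Smallness m near x becomes m' = (m M^(N₁-1))^(1/N₁) near y, to which the second propagation
applies; the exponents multiply. -/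
theorem SmallnessPropagates.trans {r : ℝ} {x y z : ℂ} (hy : y ∈ Metric.ball (0 : ℂ) r)
    (h₁ : SmallnessPropagates r x y) (h₂ : SmallnessPropagates r y z) :
    SmallnessPropagates r x z := by
  intro ρ hρ
  obtain ⟨ρ₁, hρ₁, N₁, hN₁, H₁⟩ := h₁ ρ hρ
  obtain ⟨ρ₂, hρ₂, N₂, hN₂, H₂⟩ := h₂ ρ₁ hρ₁
  refine ⟨ρ₂, hρ₂, N₁ * N₂, Nat.mul_pos hN₁ hN₂, ?_⟩
  intro h M m hd hM hm t htr htz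
  have hM0 : 0 ≤ M := (norm_nonneg _).trans (hM y hy)
  have h0 : 0 ≤ m * M ^ (N₁ - 1) :=
    le_trans (by positivity) (H₁ h M m hd hM hm y hy (Metric.mem_ball_self hρ₁))
  set m' := (m * M ^ (N₁ - 1)) ^ ((N₁ : ℝ)⁻¹) with hm'
  have hm'N : m' ^ N₁ = m * M ^ (N₁ - 1) := Real.rpow_inv_natCast_pow h0 (by omega)
  have hm'0 : 0 ≤ m' := Real.rpow_nonneg h0 _
  have h3 := H₂ h M m' hd hM (fun s hs hsy => by
    refine le_of_pow_le_pow_left₀ (n := N₁) (by omega) hm'0 ?_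
    rw [hm'N]
    exact H₁ h M m hd hM hm s hs hsy) t htr htz
  have h4 : (‖h t‖ ^ N₂) ^ N₁ ≤ (m' * M ^ (N₂ - 1)) ^ N₁ := by gcongr
  rw [mul_pow, hm'N, ← pow_mul, ← pow_mul, mul_comm N₂] at h4
  refine h4.trans_eq ?_
  rw [mul_assoc, ← pow_add]
  congr 2
  obtain ⟨a, rfl⟩ := Nat.exists_eq_add_of_le hN₁
  obtain ⟨b, rfl⟩ := Nat.exists_eq_add_of_le hN₂
  simp only [Nat.add_sub_cancel_left]
  have : (1 + a) * (1 + b) = a + b * (1 + a) + 1 := by ring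
  omega

/-- The relation is transitive and holds in both directions between nearby points, and the disk is
connected. -/
theorem smallnessPropagates {r : ℝ} {x y : ℂ} (hx : x ∈ Metric.ball (0 : ℂ) r)
    (hy : y ∈ Metric.ball (0 : ℂ) r) : SmallnessPropagates r x y := by
  refine (convex_ball (0 : ℂ) r).isPreconnected.induction₂' (SmallnessPropagates r) ?_ ?_ hx hy
  · intro z hz
    rw [mem_ball_zero_iff] at hz
    have hs : 0 < (r - ‖z‖) / 3 := by linarith
    filter_upwards [mem_nhdsWithin_of_mem_nhds (Metric.ball_mem_nhds z hs)] with w hw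
    rw [Metric.mem_ball] at hw
    constructor
    · refine smallnessPropagates_of_ball_subset (R := (r - ‖z‖) / 3) ?_ hw
      intro s hs
      rw [mem_ball_iff_norm] at hs
      rw [mem_ball_zero_iff]
      linarith [norm_le_norm_add_norm_sub' s z]
    · refine smallnessPropagates_of_ball_subset (R := (r - ‖z‖) / 3) ?_ (by rwa [Metric.mem_ball'])
      intro s hs
      rw [mem_ball_iff_norm] at hs
      rw [mem_ball_zero_iff]
      rw [dist_eq_norm] at hw
      linarith [norm_le_norm_add_norm_sub' s w, norm_le_norm_add_norm_sub' w z]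
  · intro a b c _ hb _ h1 h2
    exact h1.trans hb h2

/-! ### Smallness forced by zeros, and the minimum principle. -/

/-- Follows from |r₂² - āt|² - |r₂(t - a)|² = (r₂² - |a|²)(r₂² - |t|²): the Blaschke factor of the
disk of radius r₂ is uniformly below 1 when both its zero and its argument stay in the disk of
radius r₁. -/
theorem norm_sub_mul_le_blaschke {r₁ r₂ : ℝ} (h0 : 0 ≤ r₁) (h12 : r₁ < r₂) {a t : ℂ} (ha : ‖a‖ ≤ r₁)
    (ht : ‖t‖ ≤ r₁) : ‖(r₂ : ℂ) * (t - a)‖ ^ 2 ≤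
      (1 - ((r₂ ^ 2 - r₁ ^ 2) / (r₂ ^ 2 + r₁ ^ 2)) ^ 2) * ‖(r₂ : ℂ) ^ 2 - starRingEnd ℂ a * t‖ ^ 2 := by
  have hid : ‖(r₂ : ℂ) ^ 2 - starRingEnd ℂ a * t‖ ^ 2 - ‖(r₂ : ℂ) * (t - a)‖ ^ 2 =
      (r₂ ^ 2 - ‖a‖ ^ 2) * (r₂ ^ 2 - ‖t‖ ^ 2) := by
    rw [← Complex.normSq_eq_norm_sq, ← Complex.normSq_eq_norm_sq, ← Complex.normSq_eq_norm_sq,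
      ← Complex.normSq_eq_norm_sq]
    simp [Complex.normSq_apply, sq]
    ring
  have hup : ‖(r₂ : ℂ) ^ 2 - starRingEnd ℂ a * t‖ ≤ r₂ ^ 2 + r₁ ^ 2 := by
    refine (norm_sub_le _ _).trans ?_
    rw [norm_mul, RCLike.norm_conj, norm_pow, Complex.norm_real, Real.norm_eq_abs, sq_abs, sq r₁]
    gcongr
  have hp : 0 < r₂ ^ 2 - r₁ ^ 2 := by nlinarith
  have h1 : r₂ ^ 2 - r₁ ^ 2 ≤ r₂ ^ 2 - ‖a‖ ^ 2 := by gcongr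
  have h2 : r₂ ^ 2 - r₁ ^ 2 ≤ r₂ ^ 2 - ‖t‖ ^ 2 := by gcongr
  have h3 : ((r₂ ^ 2 - r₁ ^ 2) / (r₂ ^ 2 + r₁ ^ 2)) ^ 2 * ‖(r₂ : ℂ) ^ 2 - starRingEnd ℂ a * t‖ ^ 2 ≤
      (r₂ ^ 2 - r₁ ^ 2) * (r₂ ^ 2 - r₁ ^ 2) := by
    calc _ ≤ ((r₂ ^ 2 - r₁ ^ 2) / (r₂ ^ 2 + r₁ ^ 2)) ^ 2 * (r₂ ^ 2 + r₁ ^ 2) ^ 2 := by gcongr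
      _ = _ := by
        have : r₂ ^ 2 + r₁ ^ 2 ≠ 0 := by nlinarith
        field_simp
  have h4 := mul_le_mul h1 h2 hp.le (hp.le.trans h1)
  linarith

/-- A bounded holomorphic function with many zeros is small. -/
theorem exists_norm_le_mul_pow_card_zeros {r₁ r₂ : ℝ} (h0 : 0 < r₁) (h12 : r₁ < r₂) :
    ∃ c : ℝ, 0 < c ∧ c < 1 ∧ ∀ (S : Finset ℂ) (h : ℂ → ℂ) (M : ℝ),
      DifferentiableOn ℂ h (Metric.ball 0 r₂) → (∀ t ∈ Metric.ball (0 : ℂ) r₂, ‖h t‖ ≤ M) →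
      (∀ a ∈ S, ‖a‖ < r₁ ∧ h a = 0) →
      ∀ t ∈ Metric.ball (0 : ℂ) r₁, ‖h t‖ ≤ M * c ^ S.card := by
  -- The Blaschke factors belong to an intermediate disk, so that h is holomorphic across its
  -- boundary circle.
  obtain ⟨r₃, h13, h32⟩ := exists_between h12
  set q := (r₃ ^ 2 - r₁ ^ 2) / (r₃ ^ 2 + r₁ ^ 2) with hq
  have hq0 : 0 < q := div_pos (by nlinarith) (by positivity)
  have hq1 : q < 1 := by rw [hq, div_lt_one (by positivity)]; nlinarith
  have hr₃ : 0 < r₃ := h0.trans h13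
  refine ⟨√(1 - q ^ 2), Real.sqrt_pos.2 (by nlinarith), ?_, ?_⟩
  · rw [Real.sqrt_lt' one_pos]; nlinarith
  intro S
  -- For the induction only the bound on the closed disk of radius r₃ is kept: that is where
  -- division by a Blaschke factor preserves it.
  suffices H : ∀ (h : ℂ → ℂ) (M : ℝ), DifferentiableOn ℂ h (Metric.ball 0 r₂) →
      (∀ t ∈ Metric.closedBall (0 : ℂ) r₃, ‖h t‖ ≤ M) → (∀ a ∈ S, ‖a‖ < r₁ ∧ h a = 0) →
      ∀ t ∈ Metric.ball (0 : ℂ) r₁, ‖h t‖ ≤ M * √(1 - q ^ 2) ^ S.card from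
    fun h M hd hM hz => H h M hd (fun t ht => hM t (Metric.closedBall_subset_ball h32 ht)) hz
  induction S using Finset.induction_on with
  | empty =>
    intro h M hd hM _ t ht
    simpa using hM t (Metric.ball_subset_closedBall (Metric.ball_subset_ball h13.le ht))
  | insert a S haS ih =>
    intro h M hd hM hz t ht
    obtain ⟨ha, hha⟩ := hz a (Finset.mem_insert_self _ _)
    have ha2 : Metric.ball (0 : ℂ) r₂ ∈ 𝓝 a :=
      Metric.isOpen_ball.mem_nhds (by simpa using ha.trans h12)
    have hds : DifferentiableOn ℂ (dslope h a) (Metric.ball 0 r₂) :=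
      (Complex.differentiableOn_dslope ha2).2 hd
    -- This is h divided by the Blaschke factor of its zero a. The factor has modulus 1 on the
    -- circle of radius r₃, so g obeys the same bound M and retains the other zeros.
    set g : ℂ → ℂ := fun s => dslope h a s * (((r₃ : ℂ) ^ 2 - starRingEnd ℂ a * s) / r₃) with hg
    have hgd : DifferentiableOn ℂ g (Metric.ball 0 r₂) := hds.mul (by fun_prop)
    have hgh : ∀ s, g s * (r₃ * (s - a)) = h s * ((r₃ : ℂ) ^ 2 - starRingEnd ℂ a * s) := by
      intro s
      have e1 : (s - a) * dslope h a s = h s := by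
        simpa [hha] using sub_smul_dslope h a s
      have : (r₃ : ℂ) ≠ 0 := by exact_mod_cast hr₃.ne'
      rw [hg, ← e1]
      field_simp
    have hden : ∀ s : ℂ, ‖s‖ ≤ r₃ → 0 < ‖(r₃ : ℂ) ^ 2 - starRingEnd ℂ a * s‖ := by
      intro s hs
      have e2 := norm_sub_norm_le ((r₃ : ℂ) ^ 2) (starRingEnd ℂ a * s)
      rw [norm_mul, RCLike.norm_conj, norm_pow, Complex.norm_real, Real.norm_eq_abs, sq_abs] at e2
      have : ‖a‖ * ‖s‖ ≤ r₁ * r₃ := by gcongr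
      nlinarith
    have hgM : ∀ s ∈ Metric.closedBall (0 : ℂ) r₃, ‖g s‖ ≤ M := by
      intro s hs
      rw [← closure_ball _ hr₃.ne'] at hs
      refine Complex.norm_le_of_forall_mem_frontier_norm_le Metric.isBounded_ball
        ((hgd.mono ?_).diffContOnCl) ?_ hs
      · rw [closure_ball _ hr₃.ne']
        exact Metric.closedBall_subset_ball h32
      intro s hs
      rw [frontier_ball _ hr₃.ne', mem_sphere_zero_iff_norm] at hs
      have e3 : ‖(r₃ : ℂ) ^ 2 - starRingEnd ℂ a * s‖ = ‖(r₃ : ℂ) * (s - a)‖ := by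
        have : (r₃ : ℂ) ^ 2 - starRingEnd ℂ a * s = starRingEnd ℂ (s - a) * s := by
          rw [map_sub, sub_mul, mul_comm (starRingEnd ℂ s), Complex.mul_conj,
            Complex.normSq_eq_norm_sq, hs]
          push_cast; ring
        rw [this, norm_mul, RCLike.norm_conj, norm_mul, hs, Complex.norm_real, Real.norm_eq_abs,
          abs_of_pos hr₃, mul_comm]
      have e4 := congrArg norm (hgh s)
      rw [norm_mul, norm_mul (h s), ← e3] at e4
      rw [mul_right_cancel₀ (hden s hs.le).ne' e4]
      exact hM s (by simp [hs])
    have hgz : ∀ b ∈ S, ‖b‖ < r₁ ∧ g b = 0 := by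
      intro b hb
      obtain ⟨hb1, hb2⟩ := hz b (Finset.mem_insert_of_mem hb)
      refine ⟨hb1, ?_⟩
      have hba : b ≠ a := by rintro rfl; exact haS hb
      have e5 := hgh b
      rw [hb2, zero_mul] at e5
      refine (mul_eq_zero.1 e5).resolve_right (mul_ne_zero ?_ (sub_ne_zero.2 hba))
      exact_mod_cast hr₃.ne'
    have h5 := ih g M hgd hgM hgz t ht
    rw [mem_ball_zero_iff] at ht
    have h6 := norm_sub_mul_le_blaschke h0.le h13 ha.le ht.le
    rw [← hq] at h6
    have h7 : ‖(r₃ : ℂ) * (t - a)‖ ≤ √(1 - q ^ 2) * ‖(r₃ : ℂ) ^ 2 - starRingEnd ℂ a * t‖ := by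
      refine le_of_sq_le_sq ?_ (by positivity)
      rwa [mul_pow, Real.sq_sqrt (by nlinarith)]
    have h8 := hden t (ht.le.trans h13.le)
    have h9 := congrArg norm (hgh t)
    rw [norm_mul, norm_mul (h t)] at h9
    refine le_of_mul_le_mul_right ?_ h8
    rw [← h9, Finset.card_insert_of_notMem haS, pow_succ]
    calc ‖g t‖ * ‖(r₃ : ℂ) * (t - a)‖ ≤ (M * √(1 - q ^ 2) ^ S.card) *
          (√(1 - q ^ 2) * ‖(r₃ : ℂ) ^ 2 - starRingEnd ℂ a * t‖) :=
          mul_le_mul h5 h7 (norm_nonneg _) ((norm_nonneg _).trans h5)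
      _ = _ := by ring

/-- The minimum principle: a holomorphic function without zeros is, at the center of a disk, at least
as large as on the boundary. -/
theorem le_norm_center_of_forall_sphere {k : ℂ → ℂ} {c : ℂ} {r δ : ℝ} (hr : 0 < r) (hδ : 0 < δ)
    (hk : DifferentiableOn ℂ k (Metric.closedBall c r)) (h0 : ∀ t ∈ Metric.closedBall c r, k t ≠ 0)
    (hs : ∀ t ∈ Metric.sphere c r, δ ≤ ‖k t‖) : δ ≤ ‖k c‖ := by
  -- The maximum principle for 1/k.
  have h1 : ‖(fun t => (k t)⁻¹) c‖ ≤ δ⁻¹ := by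
    refine Complex.norm_le_of_forall_mem_frontier_norm_le (f := fun t => (k t)⁻¹) (U := Metric.ball c r)
      Metric.isBounded_ball (DifferentiableOn.diffContOnCl ?_) ?_
      (subset_closure (Metric.mem_ball_self hr))
    · rw [closure_ball _ hr.ne']
      exact hk.inv h0
    · intro t ht
      rw [frontier_ball _ hr.ne'] at ht
      rw [norm_inv]
      exact inv_anti₀ hδ (hs t ht)
  rw [norm_inv] at h1
  exact (inv_le_inv₀ (norm_pos_iff.2 (h0 c (Metric.mem_closedBall_self hr.le))) hδ).1 h1

/-! ### Parameters and transitions of flow boxes. -/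

namespace FlowBox

variable {B B' B'' : FlowBox} {X : Set (CP1 × CP1)}

/-- The transversal coordinate of the point with parameter `t` on the plaque with index `α`, relative
to the base point. -/
noncomputable def height (B : FlowBox) (α t : ℂ) : ℂ := α + B.f α t

/-- The first affine coordinate of `B.pt α t`. -/
noncomputable def coord₁ (B : FlowBox) (α t : ℂ) : ℂ :=
  if B.vertical then B.z₀ + B.height α t else B.z₀ + t

/-- The second affine coordinate of `B.pt α t`. -/
noncomputable def coord₂ (B : FlowBox) (α t : ℂ) : ℂ :=
  if B.vertical then B.w₀ + t else B.w₀ + B.height α t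

theorem pt_eq (B : FlowBox) (α t : ℂ) :
    B.pt α t = (affineChart B.chart₁ (B.coord₁ α t), affineChart B.chart₂ (B.coord₂ α t)) := by
  unfold pt coord₁ coord₂ height
  split_ifs <;> simp [add_assoc]

theorem differentiableOn_height {α : ℂ} (hα : α ∈ B.trans) :
    DifferentiableOn ℂ (B.height α) (Metric.ball 0 B.radius) :=
  (differentiableOn_const α).add (B.f_holo α hα)

theorem differentiableOn_coord₁ {α : ℂ} (hα : α ∈ B.trans) :
    DifferentiableOn ℂ (B.coord₁ α) (Metric.ball 0 B.radius) := by
  unfold coord₁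
  split_ifs
  · exact (differentiableOn_const _).add (differentiableOn_height hα)
  · fun_prop

theorem differentiableOn_coord₂ {α : ℂ} (hα : α ∈ B.trans) :
    DifferentiableOn ℂ (B.coord₂ α) (Metric.ball 0 B.radius) := by
  unfold coord₂
  split_ifs
  · fun_prop
  · exact (differentiableOn_const _).add (differentiableOn_height hα)

theorem continuousOn_pt {α : ℂ} (hα : α ∈ B.trans) :
    ContinuousOn (B.pt α) (Metric.ball 0 B.radius) := by
  have h : B.pt α =
      fun t => (affineChart B.chart₁ (B.coord₁ α t), affineChart B.chart₂ (B.coord₂ α t)) :=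
    funext fun t => B.pt_eq α t
  rw [h]
  exact ((continuous_affineChart _).comp_continuousOn (differentiableOn_coord₁ hα).continuousOn).prodMk
    ((continuous_affineChart _).comp_continuousOn (differentiableOn_coord₂ hα).continuousOn)

theorem mem_plaque {α t : ℂ} (ht : t ∈ Metric.ball (0 : ℂ) B.radius) : B.pt α t ∈ B.plaque α :=
  mem_image_of_mem _ ht

theorem mem_support_iff {x : CP1 × CP1} :
    x ∈ B.support ↔ ∃ α ∈ B.trans, ∃ t ∈ Metric.ball (0 : ℂ) B.radius, B.pt α t = x := by
  simp only [support, plaque, mem_iUnion, mem_image, exists_prop]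

theorem IsChartOf.support_subset (hB : B.IsChartOf X) : B.support ⊆ X := by
  obtain ⟨-, O, -, h⟩ := hB
  rw [h]
  exact inter_subset_right

theorem IsChartOf.pt_mem (hB : B.IsChartOf X) {α t : ℂ} (hα : α ∈ B.trans)
    (ht : t ∈ Metric.ball (0 : ℂ) B.radius) : B.pt α t ∈ X :=
  hB.support_subset (mem_support_iff.2 ⟨α, hα, t, ht, rfl⟩)

theorem IsChartOf.pt_inj (hB : B.IsChartOf X) {α β t s : ℂ} (hα : α ∈ B.trans) (hβ : β ∈ B.trans)
    (ht : t ∈ Metric.ball (0 : ℂ) B.radius) (hs : s ∈ Metric.ball (0 : ℂ) B.radius)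
    (h : B.pt α t = B.pt β s) : α = β ∧ t = s := by
  have := hB.1.injective (a₁ := (⟨α, hα⟩, ⟨t, ht⟩)) (a₂ := (⟨β, hβ⟩, ⟨s, hs⟩)) h
  simpa using this

/-- Open sets of parameters correspond to open sets of the ambient space. -/
theorem IsChartOf.exists_isOpen (hB : B.IsChartOf X) (α₀ t₀ : ℂ) (σ ρ : ℝ) :
    ∃ V : Set (CP1 × CP1), IsOpen V ∧ ∀ α ∈ B.trans, ∀ t ∈ Metric.ball (0 : ℂ) B.radius,
      (B.pt α t ∈ V ↔ α ∈ Metric.ball α₀ σ ∧ t ∈ Metric.ball t₀ ρ) := by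
  have hW : IsOpen {q : B.trans × Metric.ball (0 : ℂ) B.radius |
      (q.1 : ℂ) ∈ Metric.ball α₀ σ ∧ (q.2 : ℂ) ∈ Metric.ball t₀ ρ} :=
    (Metric.isOpen_ball.preimage (continuous_subtype_val.comp continuous_fst)).inter
      (Metric.isOpen_ball.preimage (continuous_subtype_val.comp continuous_snd))
  obtain ⟨V, hV, hVW⟩ := hB.1.isInducing.isOpen_iff.1 hW
  refine ⟨V, hV, fun α hα t ht => ?_⟩
  have := Set.ext_iff.1 hVW (⟨α, hα⟩, ⟨t, ht⟩)
  simpa using this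

/-- The points near a point of a flow box have parameters near the parameters of that point. -/
theorem IsChartOf.eventually_exists_param (hB : B.IsChartOf X) {α₀ t₀ : ℂ} (hα₀ : α₀ ∈ B.trans)
    (ht₀ : t₀ ∈ Metric.ball (0 : ℂ) B.radius) {ρ : ℝ} (hρ : 0 < ρ) :
    ∃ V : Set (CP1 × CP1), IsOpen V ∧ B.pt α₀ t₀ ∈ V ∧ ∀ x ∈ V, x ∈ X →
      ∃ α ∈ B.trans, α ∈ Metric.ball α₀ ρ ∧
        ∃ t ∈ Metric.ball (0 : ℂ) B.radius, t ∈ Metric.ball t₀ ρ ∧ B.pt α t = x := by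
  obtain ⟨V, hV, hVW⟩ := hB.exists_isOpen α₀ t₀ ρ ρ
  obtain ⟨-, O, hO, hOX⟩ := id hB
  refine ⟨V ∩ O, hV.inter hO, ⟨?_, ?_⟩, ?_⟩
  · exact (hVW α₀ hα₀ t₀ ht₀).2 ⟨Metric.mem_ball_self hρ, Metric.mem_ball_self hρ⟩
  · have : B.pt α₀ t₀ ∈ B.support := mem_support_iff.2 ⟨α₀, hα₀, t₀, ht₀, rfl⟩
    rw [hOX] at this
    exact this.1
  · rintro x ⟨hxV, hxO⟩ hxX
    have : x ∈ B.support := by rw [hOX]; exact ⟨hxO, hxX⟩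
    obtain ⟨α, hα, t, ht, rfl⟩ := mem_support_iff.1 this
    obtain ⟨h1, h2⟩ := (hVW α hα t ht).1 hxV
    exact ⟨α, hα, h1, t, ht, h2, rfl⟩

theorem IsChartOf.exists_ball_subset (hB : B.IsChartOf X) {α₀ t₀ : ℂ} (hα₀ : α₀ ∈ B.trans)
    (ht₀ : t₀ ∈ Metric.ball (0 : ℂ) B.radius) {V : Set (CP1 × CP1)} (hV : IsOpen V)
    (hx : B.pt α₀ t₀ ∈ V) :
    ∃ ρ > 0, ∀ α ∈ B.trans, α ∈ Metric.ball α₀ ρ → ∀ t ∈ Metric.ball (0 : ℂ) B.radius,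
      t ∈ Metric.ball t₀ ρ → B.pt α t ∈ V := by
  have h1 : IsOpen ((fun q : B.trans × Metric.ball (0 : ℂ) B.radius => B.pt q.1 q.2) ⁻¹' V) :=
    hV.preimage hB.1.continuous
  obtain ⟨ρ, hρ, h2⟩ := Metric.isOpen_iff.1 h1 (⟨α₀, hα₀⟩, ⟨t₀, ht₀⟩) hx
  refine ⟨ρ, hρ, fun α hα hαρ t ht htρ => ?_⟩
  have h3 : ((⟨α, hα⟩, ⟨t, ht⟩) : B.trans × Metric.ball (0 : ℂ) B.radius) ∈
      Metric.ball (⟨α₀, hα₀⟩, ⟨t₀, ht₀⟩) ρ := by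
    rw [Metric.mem_ball, Prod.dist_eq]
    exact max_lt hαρ htρ
  exact h2 h3

/-- Near a common point, the plaques of `B` are contained in plaques of `B'`. -/
theorem IsChartOf.exists_transition (hB : B.IsChartOf X) (hB' : B'.IsChartOf X)
    (hc : B.Compatible B') {α₀ t₀ α₀' t₀' : ℂ} (hα₀ : α₀ ∈ B.trans)
    (ht₀ : t₀ ∈ Metric.ball (0 : ℂ) B.radius) (hα₀' : α₀' ∈ B'.trans)
    (ht₀' : t₀' ∈ Metric.ball (0 : ℂ) B'.radius) (h : B.pt α₀ t₀ = B'.pt α₀' t₀') {ρ' : ℝ}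
    (hρ' : 0 < ρ') :
    ∃ ρ > 0, ∀ α ∈ B.trans, α ∈ Metric.ball α₀ ρ → ∃ α' ∈ B'.trans, α' ∈ Metric.ball α₀' ρ' ∧
      ∀ t ∈ Metric.ball (0 : ℂ) B.radius, t ∈ Metric.ball t₀ ρ →
        ∃ t' ∈ Metric.ball (0 : ℂ) B'.radius, t' ∈ Metric.ball t₀' ρ' ∧
          B.pt α t = B'.pt α' t' := by
  obtain ⟨V, hV, hxV, hVp⟩ := hB'.eventually_exists_param hα₀' ht₀' hρ'
  obtain ⟨ρ, hρ, hsub⟩ := hB.exists_ball_subset hα₀ ht₀ hV (h ▸ hxV)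
  refine ⟨ρ, hρ, fun α hα hαρ => ?_⟩
  have key : ∀ t ∈ Metric.ball (0 : ℂ) B.radius ∩ Metric.ball t₀ ρ,
      ∃ α' ∈ B'.trans, α' ∈ Metric.ball α₀' ρ' ∧
        ∃ t' ∈ Metric.ball (0 : ℂ) B'.radius, t' ∈ Metric.ball t₀' ρ' ∧ B'.pt α' t' = B.pt α t :=
    fun t ht => hVp _ (hsub α hα hαρ t ht.1 ht.2) (hB.pt_mem hα ht.1)
  choose! a ha hab s hs hsb hst using key
  -- Compatibility makes the index of the plaque of `B'` a locally constant function of t, and an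
  -- intersection of two disks is connected.
  have hconst : ∀ x ∈ Metric.ball (0 : ℂ) B.radius ∩ Metric.ball t₀ ρ,
      ∀ y ∈ Metric.ball (0 : ℂ) B.radius ∩ Metric.ball t₀ ρ, a x = a y := by
    intro x hx y hy
    refine ((convex_ball (0 : ℂ) B.radius).inter (convex_ball t₀ ρ)).isPreconnected.induction₂'
      (fun x y => a x = a y) ?_ (fun x y z _ _ _ => Eq.trans) hx hy
    intro z hz
    have h1 := hc α hα (a z) (ha z hz) (B.pt α z)
      ⟨mem_plaque hz.1, by rw [← hst z hz]; exact mem_plaque (hs z hz)⟩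
    have h2 : Filter.Tendsto (B.pt α)
        (𝓝[Metric.ball (0 : ℂ) B.radius ∩ Metric.ball t₀ ρ] z) (𝓝 (B.pt α z)) :=
      ((continuousOn_pt hα).mono inter_subset_left) z hz
    filter_upwards [h2.eventually h1, self_mem_nhdsWithin] with w hw hwD
    obtain ⟨s', hs', hs'w⟩ := hw.1 (mem_plaque hwD.1)
    have := (hB'.pt_inj (ha z hz) (ha w hwD) hs' (hs w hwD) (hs'w.trans (hst w hwD).symm)).1
    exact ⟨this, this.symm⟩
  have hc0 : t₀ ∈ Metric.ball (0 : ℂ) B.radius ∩ Metric.ball t₀ ρ := ⟨ht₀, Metric.mem_ball_self hρ⟩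
  refine ⟨a t₀, ha t₀ hc0, hab t₀ hc0, fun t ht htρ => ⟨s t, hs t ⟨ht, htρ⟩, hsb t ⟨ht, htρ⟩, ?_⟩⟩
  rw [hconst t₀ hc0 t ⟨ht, htρ⟩, hst t ⟨ht, htρ⟩]

theorem Compatible.symm (h : B.Compatible B') : B'.Compatible B := by
  intro α hα β hβ x hx
  filter_upwards [h β hβ α hα x hx.symm] with y hy
  exact hy.symm

/-! ### Uniform convergence of the plaques -/

/-- Joint continuity in index and parameter is not part of `FlowBox`; it comes from the continuity
of the flow box map, read through the affine charts, which are embeddings. -/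
theorem IsChartOf.continuous_height (hB : B.IsChartOf X) :
    Continuous fun q : B.trans × Metric.ball (0 : ℂ) B.radius => B.height q.1 q.2 := by
  have hc := hB.1.continuous
  simp only [pt_eq] at hc
  have h1 : Continuous fun q : B.trans × Metric.ball (0 : ℂ) B.radius => B.coord₁ q.1 q.2 :=
    (isOpenEmbedding_affineChart B.chart₁).isInducing.continuous_iff.2 hc.fst
  have h2 : Continuous fun q : B.trans × Metric.ball (0 : ℂ) B.radius => B.coord₂ q.1 q.2 :=
    (isOpenEmbedding_affineChart B.chart₂).isInducing.continuous_iff.2 hc.snd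
  by_cases hv : B.vertical = true
  · simp only [coord₁, hv, if_true] at h1
    simpa [Pi.sub_def] using h1.sub (continuous_const (y := B.z₀))
  · simp only [coord₂, hv] at h2
    simpa [Pi.sub_def] using h2.sub (continuous_const (y := B.w₀))

/-- Joint continuity becomes uniform over a compact smaller disk. -/
theorem IsChartOf.exists_norm_height_sub_lt (hB : B.IsChartOf X) {α₀ : ℂ} (hα₀ : α₀ ∈ B.trans)
    {r : ℝ} (hr : r < B.radius) {τ : ℝ} (hτ : 0 < τ) :
    ∃ σ > 0, ∀ β ∈ B.trans, β ∈ Metric.ball α₀ σ → ∀ t : ℂ, ‖t‖ ≤ r →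
      ‖B.height β t - B.height α₀ t‖ < τ := by
  set K : Set (Metric.ball (0 : ℂ) B.radius) := Subtype.val ⁻¹' Metric.closedBall (0 : ℂ) r with hK
  have hKc : IsCompact K := by
    refine IsEmbedding.subtypeVal.isCompact_preimage_iff ?_ |>.2 (isCompact_closedBall _ _)
    rw [Subtype.range_coe]
    exact Metric.closedBall_subset_ball hr
  have h1 : ∀ᶠ β : B.trans in 𝓝 ⟨α₀, hα₀⟩, ∀ t ∈ K, ‖B.height β t - B.height α₀ t‖ < τ := by
    refine hKc.eventually_forall_of_forall_eventually fun t _ => ?_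
    have hcont : Continuous fun q : B.trans × Metric.ball (0 : ℂ) B.radius =>
        ‖B.height q.1 q.2 - B.height α₀ q.2‖ := by
      refine (hB.continuous_height.sub ?_).norm
      exact hB.continuous_height.comp ((continuous_const (y := (⟨α₀, hα₀⟩ : B.trans))).prodMk
        continuous_snd)
    refine (hcont.tendsto (⟨α₀, hα₀⟩, t)).eventually_lt_const ?_
    simpa using hτ
  obtain ⟨σ, hσ, h2⟩ := Metric.eventually_nhds_iff.1 h1
  refine ⟨σ, hσ, fun β hβ hβσ t ht => ?_⟩
  exact @h2 ⟨β, hβ⟩ hβσ ⟨t, by simpa using ht.trans_lt hr⟩ (by simpa [hK] using ht)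

/-! ### Smaller flow boxes -/

/-- The flow box made of the plaques with index near `α₀`, restricted to a smaller disk. -/
noncomputable def restrict (B : FlowBox) (α₀ : ℂ) (hα₀ : α₀ ∈ B.trans) (σ : ℝ) (hσ : 0 < σ) (r : ℝ)
    (hr : 0 < r) (hrB : r ≤ B.radius) : FlowBox where
  vertical := B.vertical
  chart₁ := B.chart₁
  chart₂ := B.chart₂
  -- The index `α₀` is absorbed into the base point, so that 0 belongs to the new transversal.
  z₀ := if B.vertical then B.z₀ + α₀ else B.z₀
  w₀ := if B.vertical then B.w₀ else B.w₀ + α₀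
  radius := r
  radius_pos := hr
  trans := {a | α₀ + a ∈ B.trans ∧ ‖a‖ < σ}
  trans_bounded := Metric.isBounded_ball (x := (0 : ℂ)) (r := σ) |>.subset fun a ha => by
    simpa using ha.2
  zero_mem_trans := by simpa using ⟨hα₀, hσ⟩
  f a t := B.f (α₀ + a) t
  f_holo a ha := (B.f_holo _ ha.1).mono (Metric.ball_subset_ball hrB)
  f_zero a ha := B.f_zero _ ha.1

variable {α₀ : ℂ} {hα₀ : α₀ ∈ B.trans} {σ : ℝ} {hσ : 0 < σ} {r : ℝ} {hr : 0 < r}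
  {hrB : r ≤ B.radius}

theorem restrict_pt (a t : ℂ) : (B.restrict α₀ hα₀ σ hσ r hr hrB).pt a t = B.pt (α₀ + a) t := by
  unfold pt restrict
  split_ifs <;> simp [add_assoc]

theorem IsChartOf.restrict (hB : B.IsChartOf X) :
    (B.restrict α₀ hα₀ σ hσ r hr hrB).IsChartOf X := by
  constructor
  · let i₁ : (B.restrict α₀ hα₀ σ hσ r hr hrB).trans → B.trans := fun a => ⟨α₀ + a, a.2.1⟩
    let i₂ : Metric.ball (0 : ℂ) r → Metric.ball (0 : ℂ) B.radius :=
      inclusion (Metric.ball_subset_ball hrB)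
    have h₁ : IsEmbedding i₁ := by
      have hc : Continuous i₁ := by fun_prop
      refine IsEmbedding.of_comp hc continuous_subtype_val ?_
      exact (Homeomorph.addLeft α₀).isEmbedding.comp IsEmbedding.subtypeVal
    have h₂ : IsEmbedding i₂ := IsEmbedding.inclusion _
    have h := hB.1.comp (h₁.prodMap h₂)
    have he : (fun q : (B.restrict α₀ hα₀ σ hσ r hr hrB).trans × Metric.ball (0 : ℂ) r =>
        (B.restrict α₀ hα₀ σ hσ r hr hrB).pt q.1 q.2) =
        (fun q : B.trans × Metric.ball (0 : ℂ) B.radius => B.pt q.1 q.2) ∘ Prod.map i₁ i₂ :=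
      funext fun q => restrict_pt _ _
    exact he ▸ h
  · obtain ⟨V, hV, hVW⟩ := hB.exists_isOpen α₀ 0 σ r
    obtain ⟨-, O, hO, hOX⟩ := id hB
    refine ⟨V ∩ O, hV.inter hO, ?_⟩
    rw [inter_assoc, ← hOX]
    ext x
    rw [mem_inter_iff, mem_support_iff, mem_support_iff]
    constructor
    · rintro ⟨a, ha, t, ht, rfl⟩
      have ht' : t ∈ Metric.ball (0 : ℂ) B.radius := Metric.ball_subset_ball hrB ht
      rw [restrict_pt]
      exact ⟨(hVW _ ha.1 t ht').2 ⟨by simpa [dist_eq_norm] using ha.2, ht⟩, _, ha.1, t, ht', rfl⟩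
    · rintro ⟨hx, α, hα, t, ht, rfl⟩
      obtain ⟨h1, h2⟩ := (hVW α hα t ht).1 hx
      refine ⟨α - α₀, ⟨by simpa using hα, by simpa [dist_eq_norm] using h1⟩, t, h2, ?_⟩
      rw [restrict_pt]; simp

theorem Compatible.restrict (hB : B.IsChartOf X) (h : B.Compatible B') :
    (B.restrict α₀ hα₀ σ hσ r hr hrB).Compatible B' := by
  rintro a ha β hβ x ⟨⟨t, ht, rfl⟩, hx⟩
  have ht' : t ∈ Metric.ball (0 : ℂ) B.radius := Metric.ball_subset_ball hrB ht
  rw [restrict_pt] at hx ⊢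
  -- Near x, a point of the large plaque already has its parameter in the smaller disk. The index
  -- radius 1 is arbitrary.
  obtain ⟨V, hV, hVW⟩ := hB.exists_isOpen (α₀ + a) 0 1 r
  have hxV : B.pt (α₀ + a) t ∈ V := (hVW _ ha.1 t ht').2 ⟨Metric.mem_ball_self one_pos, ht⟩
  filter_upwards [h _ ha.1 β hβ _ ⟨mem_plaque ht', hx⟩, hV.mem_nhds hxV] with y hy hyV
  rw [← hy]
  constructor
  · rintro ⟨s, hs, rfl⟩
    rw [restrict_pt]
    exact mem_plaque (Metric.ball_subset_ball hrB hs)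
  · rintro ⟨s, hs, rfl⟩
    refine ⟨s, ((hVW _ ha.1 s hs).1 hyV).2, restrict_pt _ _⟩

end FlowBox

/-! ### The maximal atlas. -/

namespace Lamination

variable {L : Lamination} {B B' : FlowBox}

theorem isFlowBox_of_mem_atlas (h : B ∈ L.atlas) : L.IsFlowBox B :=
  ⟨L.isChart B h, fun B' hB' => L.compatible B h B' hB'⟩

theorem exists_atlas {x : CP1 × CP1} (hx : x ∈ L.carrier) :
    ∃ B ∈ L.atlas, ∃ α ∈ B.trans, ∃ t ∈ Metric.ball (0 : ℂ) B.radius, B.pt α t = x := by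
  have := L.cover hx
  simp only [mem_iUnion, FlowBox.mem_support_iff, exists_prop] at this
  exact this

/-- Near a common point both plaques coincide with the plaque of an atlas box through that point. -/
theorem IsFlowBox.compatible (hB : L.IsFlowBox B) (hB' : L.IsFlowBox B') : B.Compatible B' := by
  rintro α hα β hβ x ⟨hx, hx'⟩
  have hxX : x ∈ L.carrier := by
    obtain ⟨t, ht, rfl⟩ := hx
    exact hB.1.pt_mem hα ht
  obtain ⟨B₀, hB₀, γ, hγ, s, hs, rfl⟩ := L.exists_atlas hxX
  filter_upwards [hB.2 B₀ hB₀ α hα γ hγ _ ⟨hx, FlowBox.mem_plaque hs⟩,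
    hB'.2 B₀ hB₀ β hβ γ hγ _ ⟨hx', FlowBox.mem_plaque hs⟩] with y h1 h2
  rw [h1, h2]

end Lamination

/-! ### Isolated zeros, plaques in fibres, and leaves over infinity. -/

theorem exists_sphere_norm_ge {k : ℂ → ℂ} {U : Set ℂ} (hU : IsOpen U) {c : ℂ}
    (hk : DifferentiableOn ℂ k U) (hc : c ∈ U) (hne : ¬ ∀ᶠ t in 𝓝 c, k t = 0) {ρ : ℝ} (hρ : 0 < ρ) :
    ∃ r > 0, r < ρ ∧ Metric.closedBall c r ⊆ U ∧ ∃ δ > 0, ∀ t ∈ Metric.sphere c r, δ ≤ ‖k t‖ := by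
  have ha : AnalyticAt ℂ k c := hk.analyticAt (hU.mem_nhds hc)
  have h1 : ∀ᶠ t in 𝓝[≠] c, k t ≠ 0 :=
    ha.eventually_eq_zero_or_eventually_ne_zero.resolve_left hne
  rw [eventually_nhdsWithin_iff] at h1
  obtain ⟨R, hR, h2⟩ := Metric.eventually_nhds_iff.1 (h1.and (hU.mem_nhds hc))
  obtain ⟨r, hr0, hr⟩ := exists_between (lt_min hR hρ)
  have hrR : r < R := hr.trans_le (min_le_left _ _)
  have hsub : Metric.closedBall c r ⊆ U := fun t ht => (h2 (lt_of_le_of_lt ht hrR)).2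
  refine ⟨r, hr0, hr.trans_le (min_le_right _ _), hsub, ?_⟩
  obtain ⟨x, hx, hmin⟩ := (isCompact_sphere c r).exists_isMinOn
    (NormedSpace.sphere_nonempty.2 hr0.le)
    ((hk.continuousOn.mono (Metric.sphere_subset_closedBall.trans hsub)).norm)
  refine ⟨‖k x‖, norm_pos_iff.2 ?_, fun t ht => hmin ht⟩
  refine (h2 (lt_of_le_of_lt (Metric.sphere_subset_closedBall hx) hrR)).1 ?_
  rintro rfl
  simp at hx; linarith

theorem exists_norm_le_lt_of_mem_ball {t : ℂ} {R : ℝ} (ht : t ∈ Metric.ball (0 : ℂ) R) :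
    ∃ r, 0 < r ∧ ‖t‖ < r ∧ r < R := by
  rw [mem_ball_zero_iff] at ht
  obtain ⟨r, h1, h2⟩ := exists_between ht
  exact ⟨r, (norm_nonneg _).trans_lt h1, h1, h2⟩

theorem eqOn_ball_of_eventually_eq {k : ℂ → ℂ} {R : ℝ} {t₀ c : ℂ}
    (hk : DifferentiableOn ℂ k (Metric.ball 0 R)) (ht₀ : t₀ ∈ Metric.ball (0 : ℂ) R)
    (h : ∀ᶠ t in 𝓝 t₀, k t = c) : ∀ t ∈ Metric.ball (0 : ℂ) R, k t = c := by
  have := (hk.analyticOnNhd Metric.isOpen_ball).eqOn_of_preconnected_of_eventuallyEq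
    (g := fun _ => c) analyticOnNhd_const (convex_ball _ _).isPreconnected ht₀ h
  exact fun t ht => this ht

namespace FlowBox

variable {B : FlowBox}

/-- A fibre of the first projection contains at most one plaque of a box: in a vertical box the
fibre determines the index, and in a horizontal box the first coordinate is not constant. -/
theorem eq_of_fst_const {α β : ℂ} (hα : α ∈ B.trans) (hβ : β ∈ B.trans) {p : CP1}
    (h₁ : ∀ t ∈ Metric.ball (0 : ℂ) B.radius, (B.pt α t).1 = p)
    (h₂ : ∀ t ∈ Metric.ball (0 : ℂ) B.radius, (B.pt β t).1 = p) : α = β := by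
  have h0 : (0 : ℂ) ∈ Metric.ball (0 : ℂ) B.radius := Metric.mem_ball_self B.radius_pos
  by_cases hv : B.vertical = true
  · have := (h₁ 0 h0).trans (h₂ 0 h0).symm
    rw [pt_eq, pt_eq] at this
    simpa [coord₁, hv, height, B.f_zero α hα, B.f_zero β hβ] using affineChart_injective _ this
  · exfalso
    have hr := B.radius_pos
    have h1 : ((B.radius / 2 : ℝ) : ℂ) ∈ Metric.ball (0 : ℂ) B.radius := by
      rw [mem_ball_zero_iff, Complex.norm_real, Real.norm_eq_abs, abs_of_pos] <;> linarith
    have := (h₁ 0 h0).trans (h₁ _ h1).symm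
    rw [pt_eq, pt_eq] at this
    have := affineChart_injective _ this
    simp [coord₁, hv] at this
    exact hr.ne' this

theorem eq_of_snd_const {α β : ℂ} (hα : α ∈ B.trans) (hβ : β ∈ B.trans) {p : CP1}
    (h₁ : ∀ t ∈ Metric.ball (0 : ℂ) B.radius, (B.pt α t).2 = p)
    (h₂ : ∀ t ∈ Metric.ball (0 : ℂ) B.radius, (B.pt β t).2 = p) : α = β := by
  have h0 : (0 : ℂ) ∈ Metric.ball (0 : ℂ) B.radius := Metric.mem_ball_self B.radius_pos
  by_cases hv : B.vertical = true
  · exfalso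
    have hr := B.radius_pos
    have h1 : ((B.radius / 2 : ℝ) : ℂ) ∈ Metric.ball (0 : ℂ) B.radius := by
      rw [mem_ball_zero_iff, Complex.norm_real, Real.norm_eq_abs, abs_of_pos] <;> linarith
    have := (h₁ 0 h0).trans (h₁ _ h1).symm
    rw [pt_eq, pt_eq] at this
    have := affineChart_injective _ this
    simp [coord₂, hv] at this
    exact hr.ne' this
  · have := (h₁ 0 h0).trans (h₂ 0 h0).symm
    rw [pt_eq, pt_eq] at this
    simpa [coord₂, hv, height, B.f_zero α hα, B.f_zero β hβ] using affineChart_injective _ this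

theorem fst_const_of_eventually {α t₀ : ℂ} (hα : α ∈ B.trans)
    (ht₀ : t₀ ∈ Metric.ball (0 : ℂ) B.radius) {p : CP1} (h : ∀ᶠ t in 𝓝 t₀, (B.pt α t).1 = p) :
    ∀ t ∈ Metric.ball (0 : ℂ) B.radius, (B.pt α t).1 = p := by
  have h0 := h.self_of_nhds
  intro t ht
  rw [← h0, pt_eq, pt_eq]
  refine congrArg (affineChart _) (eqOn_ball_of_eventually_eq (differentiableOn_coord₁ hα) ht₀ ?_ t ht)
  filter_upwards [h] with s hs
  rw [← h0, pt_eq, pt_eq] at hs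
  exact affineChart_injective _ hs

theorem snd_const_of_eventually {α t₀ : ℂ} (hα : α ∈ B.trans)
    (ht₀ : t₀ ∈ Metric.ball (0 : ℂ) B.radius) {p : CP1} (h : ∀ᶠ t in 𝓝 t₀, (B.pt α t).2 = p) :
    ∀ t ∈ Metric.ball (0 : ℂ) B.radius, (B.pt α t).2 = p := by
  have h0 := h.self_of_nhds
  intro t ht
  rw [← h0, pt_eq, pt_eq]
  refine congrArg (affineChart _) (eqOn_ball_of_eventually_eq (differentiableOn_coord₂ hα) ht₀ ?_ t ht)
  filter_upwards [h] with s hs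
  rw [← h0, pt_eq, pt_eq] at hs
  exact affineChart_injective _ hs

theorem tendsto_pt {α t₀ : ℂ} (hα : α ∈ B.trans) (ht₀ : t₀ ∈ Metric.ball (0 : ℂ) B.radius) :
    Filter.Tendsto (B.pt α) (𝓝 t₀) (𝓝 (B.pt α t₀)) :=
  (continuousOn_pt hα).continuousAt (Metric.isOpen_ball.mem_nhds ht₀)

end FlowBox

namespace Lamination

variable {L : Lamination} {B : FlowBox}

theorem plaque_subset_leaf (hB : B ∈ L.atlas) {α : ℂ} (hα : α ∈ B.trans) {x y : CP1 × CP1}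
    (hy : y ∈ L.leaf x) (hyB : y ∈ B.plaque α) : B.plaque α ⊆ L.leaf x := fun _ hz =>
  Relation.ReflTransGen.tail hy ⟨B, hB, α, hα, hyB, hz⟩

theorem leaf_subset_carrier {x : CP1 × CP1} (hx : x ∈ L.carrier) : L.leaf x ⊆ L.carrier := by
  intro y hy
  induction hy with
  | refl => exact hx
  | tail _ h _ =>
    obtain ⟨B, hB, α, hα, -, t, ht, rfl⟩ := h
    exact (L.isChart B hB).pt_mem hα ht

/-- Points of the leaf near a point of its closure lie on plaques, contained in the leaf, that are
near the plaque of that point. -/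
theorem exists_plaque_subset_leaf (hB : B ∈ L.atlas) {x : CP1 × CP1} (hx : x ∈ L.carrier)
    {α₀ t₀ : ℂ} (hα₀ : α₀ ∈ B.trans) (ht₀ : t₀ ∈ Metric.ball (0 : ℂ) B.radius)
    (h : B.pt α₀ t₀ ∈ closure (L.leaf x)) {ρ : ℝ} (hρ : 0 < ρ) :
    ∃ α ∈ B.trans, α ∈ Metric.ball α₀ ρ ∧ B.plaque α ⊆ L.leaf x := by
  obtain ⟨V, hV, hxV, hVp⟩ := (L.isChart B hB).eventually_exists_param hα₀ ht₀ hρ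
  obtain ⟨y, hyV, hy⟩ := mem_closure_iff.1 h V hV hxV
  obtain ⟨α, hα, hαρ, t, ht, -, rfl⟩ := hVp y hyV (leaf_subset_carrier hx hy)
  exact ⟨α, hα, hαρ, plaque_subset_leaf hB hα hy (FlowBox.mem_plaque ht)⟩

/-- A leaf that is contained in a fibre near one of its points is compact. -/
theorem isCompact_leaf_of_eventually_const (π : CP1 × CP1 → CP1)
    (hdet : ∀ (B : FlowBox), ∀ α ∈ B.trans, ∀ β ∈ B.trans, ∀ p : CP1,
      (∀ t ∈ Metric.ball (0 : ℂ) B.radius, π (B.pt α t) = p) →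
      (∀ t ∈ Metric.ball (0 : ℂ) B.radius, π (B.pt β t) = p) → α = β)
    (hconst : ∀ (B : FlowBox), ∀ α ∈ B.trans, ∀ t₀ ∈ Metric.ball (0 : ℂ) B.radius, ∀ p : CP1,
      (∀ᶠ t in 𝓝 t₀, π (B.pt α t) = p) → ∀ t ∈ Metric.ball (0 : ℂ) B.radius, π (B.pt α t) = p)
    (hB : B ∈ L.atlas) {α t₀ : ℂ} (hα : α ∈ B.trans) (ht₀ : t₀ ∈ Metric.ball (0 : ℂ) B.radius)
    {p : CP1} (h : ∀ᶠ t in 𝓝 t₀, π (B.pt α t) = p) : IsCompact (L.leaf (B.pt α t₀)) := by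
  set x := B.pt α t₀ with hx
  have hxX : x ∈ L.carrier := (L.isChart B hB).pt_mem hα ht₀
  -- By the identity theorem, lying in the fibre passes from a plaque to every plaque meeting it,
  -- hence along chains.
  have hfib : ∀ y ∈ L.leaf x, ∃ B' ∈ L.atlas, ∃ β ∈ B'.trans, y ∈ B'.plaque β ∧
      ∀ z ∈ B'.plaque β, π z = p := by
    intro y hy
    induction hy with
    | refl =>
      refine ⟨B, hB, α, hα, FlowBox.mem_plaque ht₀, ?_⟩
      rintro _ ⟨t, ht, rfl⟩
      exact hconst B α hα t₀ ht₀ p h t ht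
    | tail _ hstep ih =>
      obtain ⟨B₁, hB₁, β₁, hβ₁, hb, hfib⟩ := ih
      obtain ⟨B₂, hB₂, β₂, hβ₂, ⟨s, hs, rfl⟩, hc⟩ := hstep
      refine ⟨B₂, hB₂, β₂, hβ₂, hc, ?_⟩
      rintro _ ⟨t, ht, rfl⟩
      refine hconst B₂ β₂ hβ₂ s hs p ?_ t ht
      have hev := L.compatible B₂ hB₂ B₁ hB₁ β₂ hβ₂ β₁ hβ₁ _ ⟨FlowBox.mem_plaque hs, hb⟩
      filter_upwards [(FlowBox.tendsto_pt hβ₂ hs).eventually hev,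
        Metric.isOpen_ball.mem_nhds hs] with r hr hrb
      exact hfib _ (hr.1 (FlowBox.mem_plaque hrb))
  refine IsClosed.isCompact (isClosed_of_closure_subset fun q hq => ?_)
  have hqX : q ∈ L.carrier :=
    closure_minimal (leaf_subset_carrier hxX) L.isClosed_carrier hq
  obtain ⟨B', hB', α₀, hα₀, s, hs, rfl⟩ := L.exists_atlas hqX
  have hval : ∀ β ∈ B'.trans, B'.plaque β ⊆ L.leaf x →
      ∀ t ∈ Metric.ball (0 : ℂ) B'.radius, π (B'.pt β t) = p := by
    intro β _ hsub t ht
    obtain ⟨_, _, _, _, h1, h2⟩ := hfib _ (hsub (FlowBox.mem_plaque ht))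
    exact h2 _ h1
  obtain ⟨β, hβ, -, hsub⟩ := exists_plaque_subset_leaf hB' hxX hα₀ hs hq one_pos
  -- Plaques of the leaf accumulate at index `α₀`, but all lie in the fibre and so have one and the
  -- same index. The limit plaque therefore belongs to the leaf, which is closed.
  have hβα : β = α₀ := by
    refine eq_of_forall_dist_le fun ε hε => ?_
    obtain ⟨γ, hγ, hγε, hsub'⟩ := exists_plaque_subset_leaf hB' hxX hα₀ hs hq hε
    rw [hdet B' β hβ γ hγ p (hval β hβ hsub) (hval γ hγ hsub')]
    exact (Metric.mem_ball.1 hγε).le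
  exact hsub (hβα ▸ FlowBox.mem_plaque hs)

theorem HasNoCompactLeaves.not_eventually_fst (hL : L.HasNoCompactLeaves) (hB : B ∈ L.atlas)
    {α t₀ : ℂ} (hα : α ∈ B.trans) (ht₀ : t₀ ∈ Metric.ball (0 : ℂ) B.radius) (c : ℂ) :
    ¬ ∀ᶠ t in 𝓝 t₀, B.coord₁ α t = c := fun h =>
  hL _ ((L.isChart B hB).pt_mem hα ht₀) <|
    isCompact_leaf_of_eventually_const Prod.fst
      (fun _ _ hα _ hβ _ => FlowBox.eq_of_fst_const hα hβ)
      (fun _ _ hα _ ht₀ _ => FlowBox.fst_const_of_eventually hα ht₀) hB hα ht₀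
      (p := affineChart B.chart₁ c) (h.mono fun t ht => by rw [FlowBox.pt_eq, ht])

theorem HasNoCompactLeaves.not_eventually_snd (hL : L.HasNoCompactLeaves) (hB : B ∈ L.atlas)
    {α t₀ : ℂ} (hα : α ∈ B.trans) (ht₀ : t₀ ∈ Metric.ball (0 : ℂ) B.radius) (c : ℂ) :
    ¬ ∀ᶠ t in 𝓝 t₀, B.coord₂ α t = c := fun h =>
  hL _ ((L.isChart B hB).pt_mem hα ht₀) <|
    isCompact_leaf_of_eventually_const Prod.snd
      (fun _ _ hα _ hβ _ => FlowBox.eq_of_snd_const hα hβ)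
      (fun _ _ hα _ ht₀ _ => FlowBox.snd_const_of_eventually hα ht₀) hB hα ht₀
      (p := affineChart B.chart₂ c) (h.mono fun t ht => by rw [FlowBox.pt_eq, ht])

/-- The closure of a leaf meets every fibre of the first projection. -/
theorem HasNoCompactLeaves.fst_image_closure_leaf (hL : L.HasNoCompactLeaves) {x : CP1 × CP1}
    (hx : x ∈ L.carrier) : Prod.fst '' closure (L.leaf x) = univ := by
  refine IsClopen.eq_univ ⟨isClosedMap_fst_of_compactSpace _ isClosed_closure, ?_⟩
    ⟨x.1, x, subset_closure .refl, rfl⟩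
  rw [isOpen_iff_mem_nhds]
  rintro _ ⟨q, hq, rfl⟩
  have hqX : q ∈ L.carrier := closure_minimal (leaf_subset_carrier hx) L.isClosed_carrier hq
  obtain ⟨B, hB, α₀, hα₀, t₀, ht₀, rfl⟩ := L.exists_atlas hqX
  have hD := Metric.isOpen_ball.mem_nhds ht₀
  -- The closure of a leaf contains the whole plaque of each of its points; with the open mapping
  -- theorem on that plaque, the projection is open.
  have hsat : ∀ s ∈ Metric.ball (0 : ℂ) B.radius, B.pt α₀ s ∈ closure (L.leaf x) := by
    intro s hs
    refine mem_closure_iff.2 fun O hO hsO => ?_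
    obtain ⟨ρ, hρ, hsub⟩ := (L.isChart B hB).exists_ball_subset hα₀ hs hO hsO
    obtain ⟨α, hα, hαρ, hpl⟩ := exists_plaque_subset_leaf hB hx hα₀ ht₀ hq hρ
    exact ⟨_, hsub α hα hαρ s hs (Metric.mem_ball_self hρ), hpl (FlowBox.mem_plaque hs)⟩
  have han : AnalyticAt ℂ (B.coord₁ α₀) t₀ :=
    (FlowBox.differentiableOn_coord₁ hα₀).analyticAt hD
  have hopen := han.eventually_constant_or_nhds_le_map_nhds.resolve_left
    (hL.not_eventually_fst hB hα₀ ht₀ _)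
  have h1 : B.coord₁ α₀ '' Metric.ball 0 B.radius ∈ 𝓝 (B.coord₁ α₀ t₀) :=
    hopen (Filter.image_mem_map hD)
  have h2 := (isOpenMap_affineChart B.chart₁).image_mem_nhds h1
  rw [FlowBox.pt_eq]
  refine Filter.mem_of_superset h2 ?_
  rintro _ ⟨_, ⟨s, hs, rfl⟩, rfl⟩
  exact ⟨_, hsat s hs, by rw [FlowBox.pt_eq]⟩

/-- Every leaf meets the fibre of the first projection over the point at infinity. -/
theorem HasNoCompactLeaves.exists_mem_leaf_fst_eq (hL : L.HasNoCompactLeaves) {x : CP1 × CP1}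
    (hx : x ∈ L.carrier) : ∃ y ∈ L.leaf x, y.1 = affineChart 0 0 := by
  have hmem : affineChart 0 0 ∈ Prod.fst '' closure (L.leaf x) := by
    rw [hL.fst_image_closure_leaf hx]; trivial
  obtain ⟨q, hq, hq1⟩ := hmem
  have hqX : q ∈ L.carrier := closure_minimal (leaf_subset_carrier hx) L.isClosed_carrier hq
  obtain ⟨B, hB, α₀, hα₀, t₀, ht₀, rfl⟩ := L.exists_atlas hqX
  rw [FlowBox.pt_eq, affineChart_eq_infinity_iff] at hq1
  obtain ⟨hchart, hzero⟩ := hq1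
  obtain ⟨r₀, -, htr₀, hr₀⟩ := exists_norm_le_lt_of_mem_ball ht₀
  obtain ⟨r, hr, -, hsub, δ, hδ, hsph⟩ := exists_sphere_norm_ge (U := Metric.ball 0 r₀)
    Metric.isOpen_ball
    ((FlowBox.differentiableOn_coord₁ hα₀).mono (Metric.ball_subset_ball hr₀.le))
    (by simpa using htr₀) (hL.not_eventually_fst hB hα₀ ht₀ 0) one_pos
  obtain ⟨σ, hσ, hclose⟩ := (L.isChart B hB).exists_norm_height_sub_lt hα₀ hr₀
    (show 0 < δ / 4 by positivity)
  obtain ⟨β, hβ, hβσ, hpl⟩ := exists_plaque_subset_leaf hB hx hα₀ ht₀ hq hσ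
  have hclose' : ∀ t ∈ Metric.closedBall t₀ r, ‖B.coord₁ β t - B.coord₁ α₀ t‖ < δ / 4 := by
    intro t ht
    have h1 := hclose β hβ hβσ t (mem_ball_zero_iff.1 (hsub ht)).le
    unfold FlowBox.coord₁
    split_ifs
    · simpa using h1
    · simpa using hδ
  -- Hurwitz's argument: without a zero, the minimum principle would give at least δ/2 at the
  -- center, where the value is below δ/4.
  have hz : ∃ t ∈ Metric.closedBall t₀ r, B.coord₁ β t = 0 := by
    by_contra! hnz
    have h1 := le_norm_center_of_forall_sphere (δ := δ / 2) hr (by positivity)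
      ((FlowBox.differentiableOn_coord₁ hβ).mono (hsub.trans (Metric.ball_subset_ball hr₀.le))) hnz
      (fun t ht => by
        have h1 := hclose' t (Metric.sphere_subset_closedBall ht)
        have h2 := hsph t ht
        have h3 := norm_sub_norm_le (B.coord₁ α₀ t) (B.coord₁ β t)
        rw [norm_sub_rev] at h3
        linarith)
    have h2 := hclose' t₀ (Metric.mem_closedBall_self hr.le)
    rw [hzero, sub_zero] at h2
    linarith
  obtain ⟨t, ht, hzt⟩ := hz
  have htB : t ∈ Metric.ball (0 : ℂ) B.radius := Metric.ball_subset_ball hr₀.le (hsub ht)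
  refine ⟨B.pt β t, hpl (FlowBox.mem_plaque htB), ?_⟩
  rw [FlowBox.pt_eq, hzt, hchart]

end Lamination

/-! ### The gap between a plaque and a sheared plaque. -/

/-- Cauchy's estimate on circles of radius (R - r)/2 bounds the derivative; the mean value
inequality does the rest. -/
theorem norm_sub_le_of_norm_le_of_ball {h : ℂ → ℂ} {M r R : ℝ} (hrR : r < R)
    (hd : DifferentiableOn ℂ h (Metric.ball 0 R)) (hM : ∀ t ∈ Metric.ball (0 : ℂ) R, ‖h t‖ ≤ M)
    {s t : ℂ} (hs : s ∈ Metric.ball (0 : ℂ) r) (ht : t ∈ Metric.ball (0 : ℂ) r) :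
    ‖h s - h t‖ ≤ 2 * M / (R - r) * ‖s - t‖ := by
  have hpos : 0 < R - r := by linarith
  refine Convex.norm_image_sub_le_of_norm_deriv_le (𝕜 := ℂ) (s := Metric.ball (0 : ℂ) r) ?_ ?_
    (convex_ball _ _) ht hs
  · exact fun x hx => hd.differentiableAt
      (Metric.isOpen_ball.mem_nhds (Metric.ball_subset_ball hrR.le hx))
  · intro x hx
    rw [mem_ball_zero_iff] at hx
    have hsub : Metric.closedBall x ((R - r) / 2) ⊆ Metric.ball 0 R := by
      intro y hy
      rw [mem_closedBall_iff_norm] at hy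
      rw [mem_ball_zero_iff]
      linarith [norm_le_norm_add_norm_sub' y x]
    have := Complex.norm_deriv_le_of_forall_mem_sphere_norm_le (f := h) (c := x) (C := M)
      (half_pos hpos) ((hd.mono (by
        rw [closure_ball _ (half_pos hpos).ne']; exact hsub)).diffContOnCl)
      fun y hy => hM y (hsub (Metric.sphere_subset_closedBall hy))
    refine this.trans_eq ?_
    field_simp

section shearCoord

variable {i : Fin 2} {ε z w : ℂ} {K : ℝ}

theorem half_le_norm_one_add_mul (hz : ‖z‖ ≤ K) (hε : ‖ε‖ * K ≤ 1 / 2) : 1 / 2 ≤ ‖1 + ε * z‖ := by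
  have h1 : ‖ε * z‖ ≤ 1 / 2 := by
    rw [norm_mul]
    exact (mul_le_mul_of_nonneg_left hz (norm_nonneg _)).trans hε
  have h2 := norm_sub_norm_le (1 : ℂ) (-(ε * z))
  rw [norm_neg, norm_one, sub_neg_eq_add] at h2
  linarith

theorem one_add_mul_ne_zero (hz : ‖z‖ ≤ K) (hε : ‖ε‖ * K ≤ 1 / 2) : 1 + ε * z ≠ 0 := by
  rw [← norm_pos_iff]
  linarith [half_le_norm_one_add_mul hz hε]

theorem norm_shearCoord_sub_le (hz : ‖z‖ ≤ K) (hε : ‖ε‖ * K ≤ 1 / 2) :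
    ‖shearCoord i ε z - z‖ ≤ 2 * (1 + K) ^ 2 * ‖ε‖ := by
  have hK : 0 ≤ K := (norm_nonneg _).trans hz
  unfold shearCoord
  split_ifs
  · have h0 := one_add_mul_ne_zero hz hε
    have h1 := half_le_norm_one_add_mul hz hε
    have h2 : z / (1 + ε * z) - z = -(ε * z ^ 2) / (1 + ε * z) := by
      rw [eq_div_iff h0, sub_mul, div_mul_cancel₀ _ h0]; ring
    rw [h2, norm_div, norm_neg, norm_mul, norm_pow, div_le_iff₀ (by linarith)]
    calc ‖ε‖ * ‖z‖ ^ 2 ≤ ‖ε‖ * (1 + K) ^ 2 := by gcongr; linarith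
      _ = 2 * (1 + K) ^ 2 * ‖ε‖ * (1 / 2) := by ring
      _ ≤ _ := by gcongr
  · rw [add_sub_cancel_left]
    refine le_mul_of_one_le_left (norm_nonneg _) ?_
    nlinarith

theorem norm_shearCoord_sub_shearCoord_le (hz : ‖z‖ ≤ K) (hw : ‖w‖ ≤ K) (hε : ‖ε‖ * K ≤ 1 / 2) :
    ‖shearCoord i ε z - shearCoord i ε w‖ ≤ 4 * ‖z - w‖ := by
  unfold shearCoord
  split_ifs
  · have h0 := one_add_mul_ne_zero hz hε
    have h1 := half_le_norm_one_add_mul hz hε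
    have h0' := one_add_mul_ne_zero hw hε
    have h1' := half_le_norm_one_add_mul hw hε
    have h2 : z / (1 + ε * z) - w / (1 + ε * w) = (z - w) / ((1 + ε * z) * (1 + ε * w)) := by
      rw [div_sub_div _ _ h0 h0']
      congr 1; ring
    rw [h2, norm_div, norm_mul, div_le_iff₀ (by nlinarith)]
    have : 1 / 4 ≤ ‖1 + ε * z‖ * ‖1 + ε * w‖ := by nlinarith
    nlinarith [norm_nonneg (z - w)]
  · rw [add_sub_add_right_eq_sub]
    nlinarith [norm_nonneg (z - w)]

theorem shearCoord_neg_shearCoord (h : 1 + ε * z ≠ 0) :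
    shearCoord i (-ε) (shearCoord i ε z) = z := by
  unfold shearCoord
  split_ifs
  · have : 1 + -ε * (z / (1 + ε * z)) = 1 / (1 + ε * z) := by
      rw [eq_div_iff h, add_mul, mul_assoc, div_mul_cancel₀ _ h]; ring
    rw [this, div_div_div_cancel_right₀ h, div_one]
  · ring

theorem differentiableAt_shearCoord (h : 1 + ε * z ≠ 0) :
    DifferentiableAt ℂ (shearCoord i ε) z := by
  unfold shearCoord
  split_ifs
  · exact differentiableAt_id.div (by fun_prop) h
  · fun_prop

end shearCoord

namespace FlowBox

variable {B : FlowBox} {X : Set (CP1 × CP1)}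

/-- The difference, in the transversal coordinate, of the plaque with index `α` and of the image
under `Phi ε` of the plaque with index `β`. -/
noncomputable def gap (B : FlowBox) (ε α β t : ℂ) : ℂ :=
  if B.vertical then B.z₀ + B.height α t - shearCoord B.chart₁ ε (B.z₀ + B.height β t)
  -- The shear moves the disk coordinate of a horizontal plaque, so the point of the image lying
  -- over t comes from the inverse shear of t.
  else B.height α t - B.height β (shearCoord B.chart₁ (-ε) (B.z₀ + t) - B.z₀)

theorem Phi_pt {ε β s : ℂ} (h : 1 + ε * B.coord₁ β s ≠ 0) :
    Phi ε (B.pt β s) = (affineChart B.chart₁ (shearCoord B.chart₁ ε (B.coord₁ β s)),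
      affineChart B.chart₂ (B.coord₂ β s)) := by
  rw [pt_eq, Phi, map_shearLin_affineChart _ _ _ h]

theorem IsChartOf.exists_uniform_bounds (hB : B.IsChartOf X) {α₀ : ℂ} (hα₀ : α₀ ∈ B.trans) {r : ℝ}
    (hr : r < B.radius) : ∃ K : ℝ, 0 < K ∧ ∃ σ > 0, ∀ β ∈ B.trans, β ∈ Metric.ball α₀ σ →
      (∀ t ∈ Metric.ball (0 : ℂ) r, ‖B.height β t‖ ≤ K) ∧
      ∀ s ∈ Metric.ball (0 : ℂ) r, ∀ t ∈ Metric.ball (0 : ℂ) r,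
        ‖B.height β s - B.height β t‖ ≤ K * ‖s - t‖ := by
  obtain ⟨r', hrr', hr'⟩ := exists_between hr
  obtain ⟨σ, hσ, hclose⟩ := hB.exists_norm_height_sub_lt hα₀ hr' one_pos
  obtain ⟨H, hH⟩ := (isCompact_closedBall (0 : ℂ) r').exists_bound_of_continuousOn
    ((differentiableOn_height hα₀).continuousOn.mono (Metric.closedBall_subset_ball hr'))
  have hpos : 0 < r' - r := by linarith
  refine ⟨max (|H| + 1) (2 * (|H| + 1) / (r' - r)), by positivity, σ, hσ, fun β hβ hβσ => ?_⟩
  have hbd : ∀ t ∈ Metric.ball (0 : ℂ) r', ‖B.height β t‖ ≤ |H| + 1 := by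
    intro t ht
    have h1 := hclose β hβ hβσ t (mem_ball_zero_iff.1 ht).le
    have h2 := hH t (Metric.ball_subset_closedBall ht)
    linarith [norm_le_norm_add_norm_sub' (B.height β t) (B.height α₀ t), le_abs_self H]
  refine ⟨fun t ht => (hbd t (Metric.ball_subset_ball hrr'.le ht)).trans (le_max_left _ _),
    fun s hs t ht => ?_⟩
  refine (norm_sub_le_of_norm_le_of_ball hrr'
    ((differentiableOn_height hβ).mono (Metric.ball_subset_ball hr'.le)) hbd hs ht).trans ?_
  gcongr
  exact le_max_right _ _

/-- The shear preserves the second coordinate, so the image plaque is a graph over the same disk and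
the comparison point is s = t. For an arbitrary s, passing from s to t costs the Lipschitz constant
of the plaque times the distance in the second coordinate. -/
theorem gap_bounds_of_vertical (hv : B.vertical = true) {ε α β : ℂ} {r r' H K C₀ : ℝ}
    (hα : α ∈ B.trans) (hβ : β ∈ B.trans) (hrr' : r < r') (hr' : r' < B.radius) (hH : 0 < H)
    (hK : ‖B.z₀‖ + ‖B.w₀‖ + H + B.radius + 2 ≤ K) (hK1 : 1 ≤ K) (hC₀ : C₀ = 2 * (1 + K) ^ 2)
    (hεK : ‖ε‖ * K ≤ 1 / 2) (hεC : C₀ * ‖ε‖ < 1)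
    (hαH : ∀ t ∈ Metric.ball (0 : ℂ) r', ‖B.height α t‖ ≤ H)
    (hβH : ∀ t ∈ Metric.ball (0 : ℂ) r', ‖B.height β t‖ ≤ H)
    (hβL : ∀ s ∈ Metric.ball (0 : ℂ) r', ∀ t ∈ Metric.ball (0 : ℂ) r',
      ‖B.height β s - B.height β t‖ ≤ H * ‖s - t‖) :
    DifferentiableOn ℂ (B.gap ε α β) (Metric.ball 0 r) ∧
      ∀ t ∈ Metric.ball (0 : ℂ) r,
        ‖B.gap ε α β t - (B.height α t - B.height β t)‖ ≤ (C₀ + H * C₀) * ‖ε‖ ∧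
        (∃ s ∈ Metric.ball (0 : ℂ) B.radius, ‖s - t‖ ≤ C₀ * ‖ε‖ ∧
          chordSum (B.pt α t) (Phi ε (B.pt β s)) ≤ ‖B.gap ε α β t‖) ∧
        ∀ s ∈ Metric.ball (0 : ℂ) r, ‖B.gap ε α β t‖ ≤
          K ^ 2 * (1 + 4 * H) * chordSum (B.pt α t) (Phi ε (B.pt β s)) := by
  have hrad := B.radius_pos
  have hC₀ε : 0 ≤ C₀ * ‖ε‖ := by rw [hC₀]; positivity
  have hsub : Metric.ball (0 : ℂ) r ⊆ Metric.ball 0 r' := Metric.ball_subset_ball hrr'.le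
  have hsub' : Metric.ball (0 : ℂ) r' ⊆ Metric.ball 0 B.radius := Metric.ball_subset_ball hr'.le
  have hwt : ∀ t ∈ Metric.ball (0 : ℂ) r', ‖B.w₀ + t‖ ≤ K := by
    intro t ht
    have := mem_ball_zero_iff.1 (hsub' ht)
    linarith [norm_add_le B.w₀ t, norm_nonneg B.z₀]
  have hzh : ∀ γ t : ℂ, ‖B.height γ t‖ ≤ H → ‖B.z₀ + B.height γ t‖ ≤ K - 1 := by
    intro γ t ht
    linarith [norm_add_le B.z₀ (B.height γ t), norm_nonneg B.w₀]
  have hsh : ∀ z : ℂ, ‖z‖ ≤ K - 1 → ‖shearCoord B.chart₁ ε z‖ ≤ K := by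
    intro z hz
    have h1 := norm_shearCoord_sub_le (i := B.chart₁) (z := z) (by linarith) hεK
    rw [← hC₀] at h1
    linarith [norm_le_norm_add_norm_sub' (shearCoord B.chart₁ ε z) z]
  have hgap : B.gap ε α β =
      fun t => B.z₀ + B.height α t - shearCoord B.chart₁ ε (B.z₀ + B.height β t) := by
    funext t; simp [gap, hv]
  have hne : ∀ t ∈ Metric.ball (0 : ℂ) r', 1 + ε * (B.z₀ + B.height β t) ≠ 0 := fun t ht =>
    one_add_mul_ne_zero ((hzh β t (hβH t ht)).trans (by linarith)) hεK
  have hpt : ∀ γ t, B.pt γ t =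
      (affineChart B.chart₁ (B.z₀ + B.height γ t), affineChart B.chart₂ (B.w₀ + t)) := by
    intro γ t; simp [pt_eq, coord₁, coord₂, hv]
  have hPhi : ∀ t ∈ Metric.ball (0 : ℂ) r', Phi ε (B.pt β t) =
      (affineChart B.chart₁ (shearCoord B.chart₁ ε (B.z₀ + B.height β t)),
        affineChart B.chart₂ (B.w₀ + t)) := by
    intro t ht
    rw [Phi_pt (by simpa [coord₁, hv] using hne t ht)]
    simp [coord₁, coord₂, hv]
  rw [hgap]
  have hdiff : ∀ γ ∈ B.trans, ∀ t ∈ Metric.ball (0 : ℂ) r',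
      DifferentiableAt ℂ (fun t => B.z₀ + B.height γ t) t := fun γ hγ t ht =>
    (differentiableAt_const _).add ((differentiableOn_height hγ).differentiableAt
      (Metric.isOpen_ball.mem_nhds (hsub' ht)))
  refine ⟨fun t ht => DifferentiableAt.differentiableWithinAt ?_, fun t ht => ⟨?_, ?_, ?_⟩⟩
  · exact (hdiff α hα t (hsub ht)).sub
      (DifferentiableAt.fun_comp' t (differentiableAt_shearCoord (hne t (hsub ht)))
        (hdiff β hβ t (hsub ht)))
  · have h1 := norm_shearCoord_sub_le (i := B.chart₁) (z := B.z₀ + B.height β t)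
      ((hzh β t (hβH t (hsub ht))).trans (by linarith)) hεK
    rw [← hC₀] at h1
    rw [show B.z₀ + B.height α t - shearCoord B.chart₁ ε (B.z₀ + B.height β t) -
      (B.height α t - B.height β t) =
      -(shearCoord B.chart₁ ε (B.z₀ + B.height β t) - (B.z₀ + B.height β t)) by ring, norm_neg]
    nlinarith [norm_nonneg ε]
  · refine ⟨t, hsub' (hsub ht), by simpa using hC₀ε, ?_⟩
    rw [hPhi t (hsub ht), hpt, chordSum, chord_self, add_zero]
    exact chord_affineChart_le _ _ _
  · intro s hs
    rw [hPhi s (hsub hs), hpt, chordSum]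
    set d₁ := chord (affineChart B.chart₁ (B.z₀ + B.height α t))
      (affineChart B.chart₁ (shearCoord B.chart₁ ε (B.z₀ + B.height β s))) with hd₁
    set d₂ := chord (affineChart B.chart₂ (B.w₀ + t)) (affineChart B.chart₂ (B.w₀ + s)) with hd₂
    have h1 := norm_sub_le_chord B.chart₁ hK1
      ((hzh α t (hαH t (hsub ht))).trans (by linarith)) (hsh _ (hzh β s (hβH s (hsub hs))))
    have h2 := norm_sub_le_chord B.chart₂ hK1 (hwt t (hsub ht)) (hwt s (hsub hs))
    rw [add_sub_add_left_eq_sub] at h2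
    have h3 := norm_shearCoord_sub_shearCoord_le (i := B.chart₁)
      (z := B.z₀ + B.height β s) (w := B.z₀ + B.height β t)
      ((hzh β s (hβH s (hsub hs))).trans (by linarith))
      ((hzh β t (hβH t (hsub ht))).trans (by linarith)) hεK
    rw [add_sub_add_left_eq_sub] at h3
    have h4 := hβL s (hsub hs) t (hsub ht)
    rw [norm_sub_rev s t] at h4
    have h5 := norm_sub_le_norm_sub_add_norm_sub (B.z₀ + B.height α t)
      (shearCoord B.chart₁ ε (B.z₀ + B.height β s))
      (shearCoord B.chart₁ ε (B.z₀ + B.height β t))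
    have h6 : 0 ≤ d₁ := chord_nonneg _ _
    have h7 : 0 ≤ d₂ := chord_nonneg _ _
    have h8 : H * ‖t - s‖ ≤ H * (K ^ 2 * d₂) := by gcongr
    have h9 : 0 ≤ K ^ 2 * d₂ := by positivity
    have h10 : 0 ≤ H * (K ^ 2 * d₁) := by positivity
    linarith

/-- The image plaque is a graph over a disk displaced by at most C₀|ε|, which must fit into the
margin r' - r. The comparison point s is the inverse shear of t; any other s is compared with it
through the Lipschitz bound of the plaque. -/
theorem gap_bounds_of_horizontal (hv : B.vertical ≠ true) {ε α β : ℂ} {r r' H K C₀ : ℝ}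
    (hα : α ∈ B.trans) (hβ : β ∈ B.trans) (hrr' : r < r') (hr' : r' < B.radius) (hH : 0 < H)
    (hK : ‖B.z₀‖ + ‖B.w₀‖ + H + B.radius + 2 ≤ K) (hK1 : 1 ≤ K) (hC₀ : C₀ = 2 * (1 + K) ^ 2)
    (hεK : ‖ε‖ * K ≤ 1 / 2) (hεC : C₀ * ‖ε‖ < 1) (hεr : C₀ * ‖ε‖ < r' - r)
    (hαH : ∀ t ∈ Metric.ball (0 : ℂ) r', ‖B.height α t‖ ≤ H)
    (hβH : ∀ t ∈ Metric.ball (0 : ℂ) r', ‖B.height β t‖ ≤ H)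
    (hβL : ∀ s ∈ Metric.ball (0 : ℂ) r', ∀ t ∈ Metric.ball (0 : ℂ) r',
      ‖B.height β s - B.height β t‖ ≤ H * ‖s - t‖) :
    DifferentiableOn ℂ (B.gap ε α β) (Metric.ball 0 r) ∧
      ∀ t ∈ Metric.ball (0 : ℂ) r,
        ‖B.gap ε α β t - (B.height α t - B.height β t)‖ ≤ (C₀ + H * C₀) * ‖ε‖ ∧
        (∃ s ∈ Metric.ball (0 : ℂ) B.radius, ‖s - t‖ ≤ C₀ * ‖ε‖ ∧
          chordSum (B.pt α t) (Phi ε (B.pt β s)) ≤ ‖B.gap ε α β t‖) ∧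
        ∀ s ∈ Metric.ball (0 : ℂ) r, ‖B.gap ε α β t‖ ≤
          K ^ 2 * (1 + 4 * H) * chordSum (B.pt α t) (Phi ε (B.pt β s)) := by
  have hrad := B.radius_pos
  have hεK' : ‖-ε‖ * K ≤ 1 / 2 := by rwa [norm_neg]
  have hC₀ε : 0 ≤ C₀ * ‖ε‖ := by rw [hC₀]; positivity
  have hsub : Metric.ball (0 : ℂ) r ⊆ Metric.ball 0 r' := Metric.ball_subset_ball hrr'.le
  have hsub' : Metric.ball (0 : ℂ) r' ⊆ Metric.ball 0 B.radius := Metric.ball_subset_ball hr'.le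
  have hzt : ∀ t ∈ Metric.ball (0 : ℂ) r', ‖B.z₀ + t‖ ≤ K - 1 := by
    intro t ht
    have := mem_ball_zero_iff.1 (hsub' ht)
    linarith [norm_add_le B.z₀ t, norm_nonneg B.w₀]
  have hwh : ∀ γ t : ℂ, ‖B.height γ t‖ ≤ H → ‖B.w₀ + B.height γ t‖ ≤ K := by
    intro γ t ht
    linarith [norm_add_le B.w₀ (B.height γ t), norm_nonneg B.z₀]
  have hsh : ∀ z : ℂ, ‖z‖ ≤ K - 1 → ‖shearCoord B.chart₁ ε z‖ ≤ K := by
    intro z hz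
    have h1 := norm_shearCoord_sub_le (i := B.chart₁) (z := z) (by linarith) hεK
    rw [← hC₀] at h1
    linarith [norm_le_norm_add_norm_sub' (shearCoord B.chart₁ ε z) z]
  have hψ : ∀ t ∈ Metric.ball (0 : ℂ) r',
      ‖(shearCoord B.chart₁ (-ε) (B.z₀ + t) - B.z₀) - t‖ ≤ C₀ * ‖ε‖ := by
    intro t ht
    have := norm_shearCoord_sub_le (i := B.chart₁) (z := B.z₀ + t)
      ((hzt t ht).trans (by linarith)) hεK'
    rwa [norm_neg, ← hC₀, ← sub_sub] at this
  have hψr : ∀ t ∈ Metric.ball (0 : ℂ) r,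
      shearCoord B.chart₁ (-ε) (B.z₀ + t) - B.z₀ ∈ Metric.ball (0 : ℂ) r' := by
    intro t ht
    have h1 := hψ t (hsub ht)
    rw [mem_ball_zero_iff] at ht ⊢
    linarith [norm_le_norm_add_norm_sub' (shearCoord B.chart₁ (-ε) (B.z₀ + t) - B.z₀) t]
  have hgap : B.gap ε α β = fun t =>
      B.height α t - B.height β (shearCoord B.chart₁ (-ε) (B.z₀ + t) - B.z₀) := by
    funext t; simp [gap, hv]
  have hpt : ∀ γ t, B.pt γ t =
      (affineChart B.chart₁ (B.z₀ + t), affineChart B.chart₂ (B.w₀ + B.height γ t)) := by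
    intro γ t; simp [pt_eq, coord₁, coord₂, hv]
  have hPhi : ∀ t ∈ Metric.ball (0 : ℂ) r', Phi ε (B.pt β t) =
      (affineChart B.chart₁ (shearCoord B.chart₁ ε (B.z₀ + t)),
        affineChart B.chart₂ (B.w₀ + B.height β t)) := by
    intro t ht
    rw [Phi_pt (by
      simpa [coord₁, hv] using one_add_mul_ne_zero ((hzt t ht).trans (by linarith)) hεK)]
    simp [coord₁, coord₂, hv]
  rw [hgap]
  have hdiff : ∀ γ ∈ B.trans, ∀ t ∈ Metric.ball (0 : ℂ) r',
      DifferentiableAt ℂ (B.height γ) t := fun γ hγ t ht =>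
    (differentiableOn_height hγ).differentiableAt (Metric.isOpen_ball.mem_nhds (hsub' ht))
  refine ⟨fun t ht => DifferentiableAt.differentiableWithinAt ?_, fun t ht => ⟨?_, ?_, ?_⟩⟩
  · have hne : 1 + -ε * (B.z₀ + t) ≠ 0 :=
      one_add_mul_ne_zero ((hzt t (hsub ht)).trans (by linarith)) hεK'
    have h1 : DifferentiableAt ℂ (fun t => shearCoord B.chart₁ (-ε) (B.z₀ + t) - B.z₀) t :=
      ((differentiableAt_shearCoord hne).comp t (by fun_prop)).sub_const _
    exact (hdiff α hα t (hsub ht)).sub (DifferentiableAt.fun_comp' t (hdiff β hβ _ (hψr t ht)) h1)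
  · have h1 := hβL t (hsub ht) _ (hψr t ht)
    have h2 := hψ t (hsub ht)
    rw [sub_sub_sub_cancel_left]
    rw [norm_sub_rev t] at h1
    have h3 : H * ‖shearCoord B.chart₁ (-ε) (B.z₀ + t) - B.z₀ - t‖ ≤ H * (C₀ * ‖ε‖) := by gcongr
    linarith
  · refine ⟨_, hsub' (hψr t ht), hψ t (hsub ht), ?_⟩
    have hne : 1 + -ε * (B.z₀ + t) ≠ 0 :=
      one_add_mul_ne_zero ((hzt t (hsub ht)).trans (by linarith)) hεK'
    have hinv := shearCoord_neg_shearCoord (i := B.chart₁) hne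
    rw [neg_neg] at hinv
    rw [hPhi _ (hψr t ht), hpt, chordSum, add_sub_cancel, hinv, chord_self, zero_add]
    refine (chord_affineChart_le _ _ _).trans ?_
    rw [add_sub_add_left_eq_sub]
  · intro s hs
    rw [hPhi s (hsub hs), hpt, chordSum]
    set d₁ := chord (affineChart B.chart₁ (B.z₀ + t))
      (affineChart B.chart₁ (shearCoord B.chart₁ ε (B.z₀ + s))) with hd₁
    set d₂ := chord (affineChart B.chart₂ (B.w₀ + B.height α t))
      (affineChart B.chart₂ (B.w₀ + B.height β s)) with hd₂
    have h1 := norm_sub_le_chord B.chart₁ hK1 ((hzt t (hsub ht)).trans (by linarith))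
      (hsh _ (hzt s (hsub hs)))
    have h2 := norm_sub_le_chord B.chart₂ hK1 (hwh α t (hαH t (hsub ht)))
      (hwh β s (hβH s (hsub hs)))
    rw [add_sub_add_left_eq_sub] at h2
    have h3 := norm_shearCoord_sub_shearCoord_le (i := B.chart₁) (ε := -ε)
      (z := B.z₀ + t) (w := shearCoord B.chart₁ ε (B.z₀ + s))
      ((hzt t (hsub ht)).trans (by linarith)) (hsh _ (hzt s (hsub hs))) hεK'
    rw [shearCoord_neg_shearCoord
      (one_add_mul_ne_zero ((hzt s (hsub hs)).trans (by linarith)) hεK), ← sub_sub] at h3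
    have h4 := hβL s (hsub hs) _ (hψr t ht)
    rw [norm_sub_rev s] at h4
    have h5 := norm_sub_le_norm_sub_add_norm_sub (B.height α t) (B.height β s)
      (B.height β (shearCoord B.chart₁ (-ε) (B.z₀ + t) - B.z₀))
    have h6 : 0 ≤ d₁ := chord_nonneg _ _
    have h7 : 0 ≤ d₂ := chord_nonneg _ _
    have h8 : H * ‖shearCoord B.chart₁ (-ε) (B.z₀ + t) - B.z₀ - s‖ ≤ H * (4 * (K ^ 2 * d₁)) := by
      gcongr; linarith
    have h9 : 0 ≤ K ^ 2 * d₁ := by positivity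
    have h10 : 0 ≤ H * (K ^ 2 * d₂) := by positivity
    linarith

/-- Comparison of the gap with the chordal distance and with the difference of the two plaques. -/
theorem IsChartOf.exists_gap_bounds (hB : B.IsChartOf X) {α₀ : ℂ} (hα₀ : α₀ ∈ B.trans) {r : ℝ}
    (hr : r < B.radius) : ∃ C : ℝ, 1 ≤ C ∧ ∃ σ > 0, ∀ ε : ℂ, ‖ε‖ < σ →
      ∀ α ∈ B.trans, α ∈ Metric.ball α₀ σ → ∀ β ∈ B.trans, β ∈ Metric.ball α₀ σ →
        DifferentiableOn ℂ (B.gap ε α β) (Metric.ball 0 r) ∧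
        ∀ t ∈ Metric.ball (0 : ℂ) r, ‖B.gap ε α β t‖ ≤ C ∧
          ‖B.gap ε α β t - (B.height α t - B.height β t)‖ ≤ C * ‖ε‖ ∧
          (∃ s ∈ Metric.ball (0 : ℂ) B.radius, ‖s - t‖ ≤ C * ‖ε‖ ∧
            chordSum (B.pt α t) (Phi ε (B.pt β s)) ≤ ‖B.gap ε α β t‖) ∧
          ∀ s ∈ Metric.ball (0 : ℂ) r,
            ‖B.gap ε α β t‖ ≤ C * chordSum (B.pt α t) (Phi ε (B.pt β s)) := by
  obtain ⟨r', hrr', hr'⟩ := exists_between hr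
  obtain ⟨H, hH, σ₀, hσ₀, hbd⟩ := hB.exists_uniform_bounds hα₀ hr'
  have hrad := B.radius_pos
  set K : ℝ := ‖B.z₀‖ + ‖B.w₀‖ + H + B.radius + 2 with hK
  have hK1 : 1 ≤ K := by rw [hK]; linarith [norm_nonneg B.z₀, norm_nonneg B.w₀]
  set C₀ : ℝ := 2 * (1 + K) ^ 2 with hC₀
  have hC₀1 : 1 ≤ C₀ := by rw [hC₀]; nlinarith
  set C : ℝ := 2 * H + C₀ + H * C₀ + K ^ 2 * (1 + 4 * H) with hC
  have hHC : 0 ≤ H * C₀ := by positivity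
  have hK2 : 1 ≤ K ^ 2 := one_le_pow₀ hK1
  have hKH : 0 ≤ K ^ 2 * (4 * H) := by positivity
  refine ⟨C, by rw [hC]; linarith, min σ₀ (min (1 / (2 * K)) (min (1 / C₀) ((r' - r) / C₀))),
    lt_min hσ₀ (lt_min (by positivity) (lt_min (by positivity)
      (div_pos (by linarith) (by linarith)))), ?_⟩
  intro ε hε α hα hασ β hβ hβσ
  simp only [lt_min_iff] at hε
  obtain ⟨-, hε1, hε2, hε3⟩ := hε
  have hεK : ‖ε‖ * K ≤ 1 / 2 := by
    rw [lt_div_iff₀ (by positivity)] at hε1; linarith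
  have hεC : C₀ * ‖ε‖ < 1 := by rw [lt_div_iff₀ (by positivity)] at hε2; linarith
  have hεr : C₀ * ‖ε‖ < r' - r := by rw [lt_div_iff₀ (by positivity)] at hε3; linarith
  have hC₀ε : 0 ≤ C₀ * ‖ε‖ := by positivity
  have hball : ∀ σ' : ℝ, Metric.ball α₀ (min σ₀ σ') ⊆ Metric.ball α₀ σ₀ := fun _ =>
    Metric.ball_subset_ball (min_le_left _ _)
  obtain ⟨hαH, hαL⟩ := hbd α hα (hball _ hασ)
  obtain ⟨hβH, hβL⟩ := hbd β hβ (hball _ hβσ)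
  have hsub : Metric.ball (0 : ℂ) r ⊆ Metric.ball 0 r' := Metric.ball_subset_ball hrr'.le
  suffices hmain : DifferentiableOn ℂ (B.gap ε α β) (Metric.ball 0 r) ∧
      ∀ t ∈ Metric.ball (0 : ℂ) r,
        ‖B.gap ε α β t - (B.height α t - B.height β t)‖ ≤ (C₀ + H * C₀) * ‖ε‖ ∧
        (∃ s ∈ Metric.ball (0 : ℂ) B.radius, ‖s - t‖ ≤ C₀ * ‖ε‖ ∧
          chordSum (B.pt α t) (Phi ε (B.pt β s)) ≤ ‖B.gap ε α β t‖) ∧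
        ∀ s ∈ Metric.ball (0 : ℂ) r, ‖B.gap ε α β t‖ ≤
          K ^ 2 * (1 + 4 * H) * chordSum (B.pt α t) (Phi ε (B.pt β s)) by
    refine ⟨hmain.1, fun t ht => ?_⟩
    obtain ⟨h1, ⟨s, hs, hst, h2⟩, h3⟩ := hmain.2 t ht
    refine ⟨?_, h1.trans ?_, ⟨s, hs, hst.trans ?_, h2⟩, fun s hs => (h3 s hs).trans ?_⟩
    · have h4 := norm_le_norm_add_norm_sub' (B.gap ε α β t) (B.height α t - B.height β t)
      have h5 := norm_sub_le (B.height α t) (B.height β t)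
      have h6 := hαH t (hsub ht)
      have h7 := hβH t (hsub ht)
      have h8 : (C₀ + H * C₀) * ‖ε‖ ≤ 1 + H := by nlinarith
      have h9 : H ≤ H * C₀ := le_mul_of_one_le_right hH.le hC₀1
      rw [hC]; linarith
    · gcongr; rw [hC]; linarith
    · gcongr; rw [hC]; linarith
    · refine mul_le_mul_of_nonneg_right ?_ (chordSum_nonneg _ _)
      rw [hC]; linarith
  by_cases hv : B.vertical = true
  · exact gap_bounds_of_vertical hv hα hβ hrr' hr' hH hK.ge hK1 hC₀ hεK hεC hαH hβH hβL
  · exact gap_bounds_of_horizontal hv hα hβ hrr' hr' hH hK.ge hK1 hC₀ hεK hεC hεr hαH hβH hβL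

end FlowBox

/-! ### Separation over the point at infinity. -/

/-- Strict differentiability at each point gives the estimate for base points nearby; compactness
makes η uniform. -/
theorem exists_expansion_on_compact {g : ℂ → ℂ} {U : Set ℂ} (hU : IsOpen U)
    (hg : DifferentiableOn ℂ g U) {S : Set ℂ} (hS : IsCompact S) (hSU : S ⊆ U) {δ : ℝ} (hδ : 0 < δ)
    (hder : ∀ t ∈ S, δ ≤ ‖deriv g t‖) :
    ∃ η > 0, ∀ e : ℂ, ‖e‖ < η → ∀ t ∈ S, δ / 2 * ‖e‖ ≤ ‖g (t + e) - g t‖ := by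
  have h1 : ∀ᶠ e in 𝓝 (0 : ℂ), ∀ t ∈ S, δ / 2 * ‖e‖ ≤ ‖g (t + e) - g t‖ := by
    refine hS.eventually_forall_of_forall_eventually fun t ht => ?_
    have h2 : HasStrictDerivAt g (deriv g t) t :=
      (hg.analyticAt (hU.mem_nhds (hSU ht))).hasStrictDerivAt
    have h3 := h2.hasStrictFDerivAt.isLittleO.def (half_pos hδ)
    have h4 : Filter.Tendsto (fun q : ℂ × ℂ => (q.2 + q.1, q.2)) (𝓝 (0, t)) (𝓝 (t, t)) := by
      have : Continuous fun q : ℂ × ℂ => (q.2 + q.1, q.2) := by fun_prop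
      simpa using this.tendsto (0, t)
    filter_upwards [h4.eventually h3] with q hq
    have h5 := norm_sub_norm_le (deriv g t * q.1) (deriv g t * q.1 - (g (q.2 + q.1) - g q.2))
    rw [sub_sub_cancel, norm_mul] at h5
    have h6 : ‖deriv g t * q.1 - (g (q.2 + q.1) - g q.2)‖ ≤ δ / 2 * ‖q.1‖ := by
      rw [norm_sub_rev]
      simpa [mul_comm] using hq
    have h7 := mul_le_mul_of_nonneg_right (hder t ht) (norm_nonneg q.1)
    linarith
  obtain ⟨η, hη, h2⟩ := Metric.eventually_nhds_iff.1 h1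
  exact ⟨η, hη, fun e he => h2 (by simpa using he)⟩

namespace FlowBox

variable {B : FlowBox} {X : Set (CP1 × CP1)}

theorem IsChartOf.height_ne (hB : B.IsChartOf X) {α β t : ℂ} (hα : α ∈ B.trans) (hβ : β ∈ B.trans)
    (hne : α ≠ β) (ht : t ∈ Metric.ball (0 : ℂ) B.radius) : B.height α t ≠ B.height β t := by
  intro h
  refine hne (hB.pt_inj hα hβ ht ht ?_).1
  simp only [pt_eq, coord₁, coord₂, h]

/-- Disjoint plaques that are far apart along a circle are far apart at its center. -/
theorem IsChartOf.le_norm_height_sub (hB : B.IsChartOf X) {α β t₀ : ℂ} (hα : α ∈ B.trans)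
    (hβ : β ∈ B.trans) {r δ : ℝ} (hr : 0 < r) (hδ : 0 < δ)
    (hsub : Metric.closedBall t₀ r ⊆ Metric.ball 0 B.radius)
    (hs : ∀ t ∈ Metric.sphere t₀ r, δ ≤ ‖B.height α t - B.height β t‖) :
    δ ≤ ‖B.height α t₀ - B.height β t₀‖ := by
  by_cases hne : α = β
  · exfalso
    obtain ⟨t, ht⟩ := NormedSpace.sphere_nonempty (E := ℂ) (x := t₀) |>.2 hr.le
    have := hs t ht
    rw [hne, sub_self, norm_zero] at this
    linarith
  · exact le_norm_center_of_forall_sphere (k := fun t => B.height α t - B.height β t) hr hδ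
      (((differentiableOn_height hα).mono hsub).sub ((differentiableOn_height hβ).mono hsub))
      (fun t ht => sub_ne_zero.2 (hB.height_ne hα hβ hne (hsub ht))) hs

/-- With z the first coordinate on the plaque β, the difference of heights equals the gap minus
εz²/(1+εz). If the gap were below σ|ε| throughout, this difference would be at least |ε|δ²/12 on a
circle around `t₀` where z stays away from 0, but smaller at `t₀`, where z is nearly 0. This
contradicts the minimum principle for disjoint plaques. -/
theorem IsChartOf.exists_le_norm_gap_of_vertical (hB : B.IsChartOf X) (hv : B.vertical = true)
    (hchart : B.chart₁ = 0) {α₀ t₀ : ℂ} (hα₀ : α₀ ∈ B.trans) {r : ℝ} (hr : r < B.radius)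
    (ht₀ : t₀ ∈ Metric.ball (0 : ℂ) r) (hzero : B.coord₁ α₀ t₀ = 0)
    (hne : ¬ ∀ᶠ t in 𝓝 t₀, B.coord₁ α₀ t = 0) {ρ : ℝ} (hρ : 0 < ρ) :
    ∃ σ > 0, ∀ ε : ℂ, 0 < ‖ε‖ → ‖ε‖ < σ → ∀ α ∈ B.trans, α ∈ Metric.ball α₀ σ →
      ∀ β ∈ B.trans, β ∈ Metric.ball α₀ σ →
      ∃ t ∈ Metric.ball (0 : ℂ) r, t ∈ Metric.ball t₀ ρ ∧ σ * ‖ε‖ ≤ ‖B.gap ε α β t‖ := by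
  have hrB : Metric.ball (0 : ℂ) r ⊆ Metric.ball 0 B.radius := Metric.ball_subset_ball hr.le
  obtain ⟨r', hr', hr'ρ, hsub, δ, hδ, hsph⟩ := exists_sphere_norm_ge Metric.isOpen_ball
    ((differentiableOn_coord₁ hα₀).mono hrB) ht₀ hne hρ
  obtain ⟨σ₁, hσ₁, hclose⟩ := hB.exists_norm_height_sub_lt hα₀ hr (show 0 < δ / 10 by positivity)
  obtain ⟨K, hK, σ₂, hσ₂, hbd⟩ := hB.exists_uniform_bounds hα₀ hr
  have hc : ∀ γ t, B.coord₁ γ t = B.z₀ + B.height γ t := fun γ t => by simp [coord₁, hv]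
  have hKz : 0 < 2 * (K + ‖B.z₀‖) := by positivity
  refine ⟨min (min σ₁ σ₂) (min (1 / (2 * (K + ‖B.z₀‖))) (δ ^ 2 / 50)), by positivity, ?_⟩
  set σ := min (min σ₁ σ₂) (min (1 / (2 * (K + ‖B.z₀‖))) (δ ^ 2 / 50)) with hσ
  have hσ1 : σ ≤ σ₁ := (min_le_left _ _).trans (min_le_left _ _)
  have hσ2 : σ ≤ σ₂ := (min_le_left _ _).trans (min_le_right _ _)
  have hσ3 : σ ≤ 1 / (2 * (K + ‖B.z₀‖)) := (min_le_right _ _).trans (min_le_left _ _)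
  have hσ4 : σ ≤ δ ^ 2 / 50 := (min_le_right _ _).trans (min_le_right _ _)
  intro ε hε0 hε α hα hασ β hβ hβσ
  by_contra! hcon
  have hgap : ∀ t ∈ Metric.closedBall t₀ r', ‖B.gap ε α β t‖ < σ * ‖ε‖ := fun t ht =>
    hcon t (hsub ht) (lt_of_le_of_lt ht hr'ρ)
  have hGβ : ∀ t ∈ Metric.closedBall t₀ r', ‖B.coord₁ β t‖ ≤ K + ‖B.z₀‖ := by
    intro t ht
    rw [hc]
    have := (hbd β hβ (Metric.ball_subset_ball hσ2 hβσ)).1 t (hsub ht)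
    linarith [norm_add_le B.z₀ (B.height β t)]
  have hεK : ‖ε‖ * (K + ‖B.z₀‖) ≤ 1 / 2 := by
    have := hε.le.trans hσ3
    rw [le_div_iff₀ hKz] at this
    linarith
  have hdiff : ∀ t ∈ Metric.closedBall t₀ r', B.height α t - B.height β t =
      B.gap ε α β t - ε * (B.coord₁ β t ^ 2 / (1 + ε * B.coord₁ β t)) := by
    intro t ht
    have h0 := one_add_mul_ne_zero (hGβ t ht) hεK
    have h1 : B.coord₁ β t / (1 + ε * B.coord₁ β t) =
        B.coord₁ β t - ε * (B.coord₁ β t ^ 2 / (1 + ε * B.coord₁ β t)) := by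
      rw [div_eq_iff h0, sub_mul, mul_assoc, div_mul_cancel₀ _ h0]; ring
    simp only [gap, hv, if_true, shearCoord, hchart, ← hc, h1]
    rw [hc, hc]; ring
  have hcl : ∀ t ∈ Metric.closedBall t₀ r', ‖B.coord₁ β t - B.coord₁ α₀ t‖ < δ / 10 := by
    intro t ht
    rw [hc, hc, add_sub_add_left_eq_sub]
    exact hclose β hβ (Metric.ball_subset_ball hσ1 hβσ) t (mem_ball_zero_iff.1 (hsub ht)).le
  have hcen := Metric.mem_closedBall_self (x := t₀) hr'.le
  have hlow : ∀ t ∈ Metric.sphere t₀ r', ‖ε‖ * (δ ^ 2 / 12) ≤ ‖B.height α t - B.height β t‖ := by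
    intro t ht
    have ht' := Metric.sphere_subset_closedBall ht
    have h1 : δ / 2 ≤ ‖B.coord₁ β t‖ := by
      have h2 := hcl t ht'
      have h3 := hsph t ht
      have h4 := norm_sub_norm_le (B.coord₁ α₀ t) (B.coord₁ β t)
      rw [norm_sub_rev] at h4
      linarith
    have h5 : ‖1 + ε * B.coord₁ β t‖ ≤ 3 / 2 := by
      have h6 := norm_add_le 1 (ε * B.coord₁ β t)
      rw [norm_one, norm_mul] at h6
      have h7 := mul_le_mul_of_nonneg_left (hGβ t ht') (norm_nonneg ε)
      linarith
    have h8 : δ ^ 2 / 6 ≤ ‖B.coord₁ β t ^ 2 / (1 + ε * B.coord₁ β t)‖ := by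
      rw [norm_div, norm_pow,
        le_div_iff₀ (norm_pos_iff.2 (one_add_mul_ne_zero (hGβ t ht') hεK))]
      calc δ ^ 2 / 6 * ‖1 + ε * B.coord₁ β t‖ ≤ δ ^ 2 / 6 * (3 / 2) := by gcongr
        _ = (δ / 2) ^ 2 := by ring
        _ ≤ _ := by gcongr
    rw [hdiff t ht']
    have h9 := norm_sub_norm_le (ε * (B.coord₁ β t ^ 2 / (1 + ε * B.coord₁ β t))) (B.gap ε α β t)
    rw [norm_mul, norm_sub_rev] at h9
    have h10 := mul_le_mul_of_nonneg_left h8 (norm_nonneg ε)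
    have h11 := hgap t ht'
    have h12 := mul_le_mul_of_nonneg_right hσ4 (norm_nonneg ε)
    nlinarith
  -- The center now needs at least |ε|δ²/12, while |z| < δ/10 allows at most 2|ε|δ²/50.
  have hmin := hB.le_norm_height_sub hα hβ hr' (by positivity) (hsub.trans hrB) hlow
  rw [hdiff t₀ hcen] at hmin
  have h1 := hcl t₀ hcen
  rw [hzero, sub_zero] at h1
  have h2 := half_le_norm_one_add_mul (hGβ t₀ hcen) hεK
  have h3 : ‖B.coord₁ β t₀ ^ 2 / (1 + ε * B.coord₁ β t₀)‖ ≤ δ ^ 2 / 50 := by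
    rw [norm_div, norm_pow, div_le_iff₀ (by linarith)]
    calc ‖B.coord₁ β t₀‖ ^ 2 ≤ (δ / 10) ^ 2 := by gcongr
      _ = δ ^ 2 / 50 * (1 / 2) := by ring
      _ ≤ _ := by gcongr
  have h4 := norm_sub_le (B.gap ε α β t₀)
    (ε * (B.coord₁ β t₀ ^ 2 / (1 + ε * B.coord₁ β t₀)))
  rw [norm_mul] at h4
  have h5 := mul_le_mul_of_nonneg_left h3 (norm_nonneg ε)
  have h6 := hgap t₀ hcen
  have h7 := mul_le_mul_of_nonneg_right hσ4 (norm_nonneg ε)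
  nlinarith [mul_pos hε0 (sq_pos_of_pos hδ)]

/-- The inverse shear fixes the parameter `t₀` and moves t by e, of size about |ε||t - t₀|². On a
circle where the slope of the plaques is bounded below, moving by e changes the height by a multiple
of |e|; a tiny gap therefore forces the plaques to be about |ε| apart there. At `t₀` the gap is
exactly the difference of heights, which contradicts the minimum principle. -/
theorem IsChartOf.exists_le_norm_gap_of_horizontal (hB : B.IsChartOf X) (hv : B.vertical ≠ true)
    (hchart : B.chart₁ = 0) {α₀ t₀ : ℂ} (hα₀ : α₀ ∈ B.trans) {r : ℝ} (hr : r < B.radius)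
    (ht₀ : t₀ ∈ Metric.ball (0 : ℂ) r) (hzero : B.coord₁ α₀ t₀ = 0)
    (hne : ∀ c, ¬ ∀ᶠ t in 𝓝 t₀, B.coord₂ α₀ t = c) {ρ : ℝ} (hρ : 0 < ρ) :
    ∃ σ > 0, ∀ ε : ℂ, 0 < ‖ε‖ → ‖ε‖ < σ → ∀ α ∈ B.trans, α ∈ Metric.ball α₀ σ →
      ∀ β ∈ B.trans, β ∈ Metric.ball α₀ σ →
      ∃ t ∈ Metric.ball (0 : ℂ) r, t ∈ Metric.ball t₀ ρ ∧ σ * ‖ε‖ ≤ ‖B.gap ε α β t‖ := by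
  have hrB : Metric.ball (0 : ℂ) r ⊆ Metric.ball 0 B.radius := Metric.ball_subset_ball hr.le
  have hz : B.z₀ = -t₀ := by
    simp only [coord₁, hv] at hzero
    simpa using eq_neg_of_add_eq_zero_left hzero
  have hder : ¬ ∀ᶠ t in 𝓝 t₀, deriv (B.height α₀) t = 0 := by
    intro h
    obtain ⟨η, hη, h1⟩ := Metric.eventually_nhds_iff_ball.1
      (h.and (Metric.isOpen_ball.mem_nhds (hrB ht₀)))
    refine hne (B.w₀ + B.height α₀ t₀) ?_
    filter_upwards [Metric.ball_mem_nhds t₀ hη] with t ht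
    have h2 := Convex.norm_image_sub_le_of_norm_deriv_le (𝕜 := ℂ) (f := B.height α₀) (C := 0)
      (s := Metric.ball t₀ η) (fun x hx => (differentiableOn_height hα₀).differentiableAt
        (Metric.isOpen_ball.mem_nhds (h1 x hx).2)) (fun x hx => by simp [(h1 x hx).1])
      (convex_ball _ _) (Metric.mem_ball_self hη) ht
    rw [zero_mul, norm_le_zero_iff, sub_eq_zero] at h2
    simp [coord₂, hv, h2]
  obtain ⟨r₁, -, ht₀r₁, hr₁⟩ := exists_norm_le_lt_of_mem_ball ht₀
  obtain ⟨R, hrR, hR⟩ := exists_between hr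
  obtain ⟨r', hr', hr'ρ, hsub₁, δ, hδ, hsph⟩ := exists_sphere_norm_ge
    (U := Metric.ball (0 : ℂ) r₁) Metric.isOpen_ball
    (((differentiableOn_height hα₀).deriv Metric.isOpen_ball).mono
      (Metric.ball_subset_ball (hr₁.trans hr).le)) (by simpa using ht₀r₁) hder (lt_min hρ one_pos)
  have hr'1 : r' < 1 := hr'ρ.trans_le (min_le_right _ _)
  have hsub : Metric.closedBall t₀ r' ⊆ Metric.ball 0 r :=
    hsub₁.trans (Metric.ball_subset_ball hr₁.le)
  obtain ⟨η, hη, hexp⟩ := exists_expansion_on_compact Metric.isOpen_ball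
    (differentiableOn_height hα₀) (isCompact_sphere t₀ r')
    ((Metric.sphere_subset_closedBall.trans hsub).trans hrB) hδ hsph
  have hRr : 0 < R - r := by linarith
  -- The closeness is chosen so that, by Cauchy's estimate, the increments of β differ from those of
  -- `α₀` by at most δ/4 |e|, half of the expansion δ/2 |e|.
  obtain ⟨σ₁, hσ₁, hclose⟩ := hB.exists_norm_height_sub_lt hα₀ hR
    (show 0 < (R - r) * δ / 8 by positivity)
  have hr₁r : 0 < r - r₁ := by linarith
  refine ⟨min (min σ₁ (1 / 2)) (min (min (η / 8) ((r - r₁) / 8)) (δ * r' ^ 2 / 12)), by positivity, ?_⟩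
  set σ := min (min σ₁ (1 / 2)) (min (min (η / 8) ((r - r₁) / 8)) (δ * r' ^ 2 / 12)) with hσ
  have hσ1 : σ ≤ σ₁ := (min_le_left _ _).trans (min_le_left _ _)
  have hσ2 : σ ≤ 1 / 2 := (min_le_left _ _).trans (min_le_right _ _)
  have hσ3 : σ ≤ η / 8 := (min_le_right _ _).trans ((min_le_left _ _).trans (min_le_left _ _))
  have hσ4 : σ ≤ (r - r₁) / 8 := (min_le_right _ _).trans ((min_le_left _ _).trans (min_le_right _ _))
  have hσ5 : σ ≤ δ * r' ^ 2 / 12 := (min_le_right _ _).trans (min_le_right _ _)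
  intro ε hε0 hε α hα hασ β hβ hβσ
  by_contra! hcon
  have hgap : ∀ t ∈ Metric.closedBall t₀ r', ‖B.gap ε α β t‖ < σ * ‖ε‖ := fun t ht =>
    hcon t (hsub ht) (lt_of_le_of_lt ht (hr'ρ.trans_le (min_le_left _ _)))
  have hεK : ‖-ε‖ * 1 ≤ 1 / 2 := by rw [norm_neg]; linarith
  have hgapeq : ∀ t, B.gap ε α β t =
      B.height α t - B.height β (shearCoord 0 (-ε) (B.z₀ + t) - B.z₀) := fun t => by
    simp [gap, hv, hchart]
  have hlow : ∀ t ∈ Metric.sphere t₀ r',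
      δ * r' ^ 2 / 12 * ‖ε‖ ≤ ‖B.height α t - B.height β t‖ := by
    intro t ht
    have ht' := Metric.sphere_subset_closedBall ht
    have hu : ‖B.z₀ + t‖ = r' := by
      rw [hz, neg_add_eq_sub]; simpa using mem_sphere_iff_norm.1 ht
    have hu1 : ‖B.z₀ + t‖ ≤ 1 := hu.le.trans hr'1.le
    set e : ℂ := shearCoord 0 (-ε) (B.z₀ + t) - (B.z₀ + t) with he
    have hψ : shearCoord 0 (-ε) (B.z₀ + t) - B.z₀ = t + e := by rw [he]; ring
    have he1 : ‖e‖ ≤ 8 * ‖ε‖ := by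
      have := norm_shearCoord_sub_le (i := 0) hu1 hεK
      rw [norm_neg] at this
      linarith
    have he2 : 2 / 3 * r' ^ 2 * ‖ε‖ ≤ ‖e‖ := by
      have h0 := one_add_mul_ne_zero hu1 hεK
      have h1 : e = ε * (B.z₀ + t) ^ 2 / (1 + -ε * (B.z₀ + t)) := by
        rw [he, shearCoord, if_pos rfl, eq_div_iff h0, sub_mul, div_mul_cancel₀ _ h0]; ring
      rw [h1, norm_div, norm_mul, norm_pow, hu, le_div_iff₀ (norm_pos_iff.2 h0)]
      have h2 : ‖1 + -ε * (B.z₀ + t)‖ ≤ 3 / 2 := by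
        have h3 := norm_add_le 1 (-ε * (B.z₀ + t))
        rw [norm_one, norm_mul] at h3
        have h4 := mul_le_mul_of_nonneg_left hu1 (norm_nonneg (-ε))
        linarith
      calc 2 / 3 * r' ^ 2 * ‖ε‖ * ‖1 + -ε * (B.z₀ + t)‖ ≤ 2 / 3 * r' ^ 2 * ‖ε‖ * (3 / 2) := by gcongr
        _ = ‖ε‖ * r' ^ 2 := by ring
    have hte : t + e ∈ Metric.ball (0 : ℂ) r := by
      have h1 := mem_ball_zero_iff.1 (hsub₁ ht')
      rw [mem_ball_zero_iff]
      linarith [norm_add_le t e]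
    have h1 := hexp e (by linarith) t ht
    have h2 := norm_sub_le_of_norm_le_of_ball (h := fun t => B.height β t - B.height α₀ t) hrR
      (((differentiableOn_height hβ).sub (differentiableOn_height hα₀)).mono
        (Metric.ball_subset_ball hR.le))
      (fun t ht => (hclose β hβ (Metric.ball_subset_ball hσ1 hβσ) t (mem_ball_zero_iff.1 ht).le).le)
      hte (hsub ht')
    have h3 : 2 * ((R - r) * δ / 8) / (R - r) = δ / 4 := by field_simp; norm_num
    rw [h3, add_sub_cancel_left] at h2
    have h4 := norm_sub_norm_le (B.height α₀ (t + e) - B.height α₀ t)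
      (-(B.height β (t + e) - B.height α₀ (t + e) - (B.height β t - B.height α₀ t)))
    rw [norm_neg, sub_neg_eq_add, show B.height α₀ (t + e) - B.height α₀ t +
      (B.height β (t + e) - B.height α₀ (t + e) - (B.height β t - B.height α₀ t)) =
      B.height β (t + e) - B.height β t by ring] at h4
    have h5 := hgap t ht'
    rw [hgapeq, hψ] at h5
    have h6 := norm_sub_norm_le (B.height β (t + e) - B.height β t)
      (-(B.height α t - B.height β (t + e)))
    rw [norm_neg, show B.height β (t + e) - B.height β t - -(B.height α t - B.height β (t + e)) =
      B.height α t - B.height β t by ring] at h6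
    have h7 := mul_le_mul_of_nonneg_right hσ5 (norm_nonneg ε)
    have h8 : δ / 4 * (2 / 3 * r' ^ 2 * ‖ε‖) ≤ δ / 4 * ‖e‖ := by gcongr
    linarith
  have hmin := hB.le_norm_height_sub hα hβ hr' (by positivity) (hsub.trans hrB) hlow
  have hcen := hgap t₀ (Metric.mem_closedBall_self hr'.le)
  rw [hgapeq, hz] at hcen
  simp only [neg_add_cancel, shearCoord, if_true, zero_div, sub_neg_eq_add, zero_add] at hcen
  have h7 := mul_le_mul_of_nonneg_right hσ5 (norm_nonneg ε)
  linarith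

/-- Quantitative separation, near the point with parameters `(α₀, t₀)`, of the plaques from the
images of the plaques under `Phi ε`. -/
def IsSeparated (B : FlowBox) (lip : Prop) (α₀ t₀ : ℂ) : Prop :=
  -- The radius R for the competing points s is fixed before ρ, so t can be placed as near `t₀` as
  -- the propagation requires without shrinking the range of s. The chordal distance keeps the
  -- notion independent of charts. The proposition `lip` stands for the Lipschitz case, where the
  -- exponent must stay 1.
  ∃ R > 0, ∀ ρ > 0, ∃ σ > 0, ∃ κ : ℕ, 1 ≤ κ ∧ (lip → κ = 1) ∧
    ∀ ε : ℂ, 0 < ‖ε‖ → ‖ε‖ < σ → ∀ α ∈ B.trans, α ∈ Metric.ball α₀ σ →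
      ∀ β ∈ B.trans, β ∈ Metric.ball α₀ σ →
      ∃ t ∈ Metric.ball (0 : ℂ) B.radius, t ∈ Metric.ball t₀ ρ ∧
        ∀ s ∈ Metric.ball (0 : ℂ) B.radius, s ∈ Metric.ball t₀ R →
          σ * ‖ε‖ ^ κ ≤ chordSum (B.pt α t) (Phi ε (B.pt β s))

/-- Separation holds over the point at infinity, where the vector field generating `Phi` vanishes. -/
theorem isSeparated_of_fst_eq_infinity {L : Lamination} (hL : L.HasNoCompactLeaves)
    (hBL : B ∈ L.atlas) {α₀ t₀ : ℂ} (hα₀ : α₀ ∈ B.trans)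
    (ht₀ : t₀ ∈ Metric.ball (0 : ℂ) B.radius) (h : (B.pt α₀ t₀).1 = affineChart 0 0) (lip : Prop) :
    B.IsSeparated lip α₀ t₀ := by
  have hB := L.isChart B hBL
  rw [pt_eq, affineChart_eq_infinity_iff] at h
  obtain ⟨hchart, hzero⟩ := h
  obtain ⟨r, -, ht₀r, hr⟩ := exists_norm_le_lt_of_mem_ball ht₀
  have hrB : Metric.ball (0 : ℂ) r ⊆ Metric.ball 0 B.radius := Metric.ball_subset_ball hr.le
  have ht₀' : t₀ ∈ Metric.ball (0 : ℂ) r := by simpa using ht₀r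
  obtain ⟨C, hC, σ₁, hσ₁, hgap⟩ := hB.exists_gap_bounds hα₀ hr
  refine ⟨r - ‖t₀‖, by linarith, fun ρ hρ => ?_⟩
  have hcore : ∃ σ > 0, ∀ ε : ℂ, 0 < ‖ε‖ → ‖ε‖ < σ → ∀ α ∈ B.trans, α ∈ Metric.ball α₀ σ →
      ∀ β ∈ B.trans, β ∈ Metric.ball α₀ σ →
      ∃ t ∈ Metric.ball (0 : ℂ) r, t ∈ Metric.ball t₀ ρ ∧ σ * ‖ε‖ ≤ ‖B.gap ε α β t‖ := by
    by_cases hv : B.vertical = true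
    · exact hB.exists_le_norm_gap_of_vertical hv hchart hα₀ hr ht₀' hzero
        (hL.not_eventually_fst hBL hα₀ ht₀ 0) hρ
    · exact hB.exists_le_norm_gap_of_horizontal hv hchart hα₀ hr ht₀' hzero
        (hL.not_eventually_snd hBL hα₀ ht₀) hρ
  obtain ⟨σ₂, hσ₂, hcore⟩ := hcore
  refine ⟨min σ₁ (σ₂ / C), by positivity, 1, le_rfl, fun _ => rfl, ?_⟩
  have hσ2 : min σ₁ (σ₂ / C) ≤ σ₂ := (min_le_right _ _).trans (div_le_self hσ₂.le hC)
  intro ε hε0 hε α hα hασ β hβ hβσ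
  obtain ⟨t, ht, htρ, hle⟩ := hcore ε hε0 (hε.trans_le hσ2) α hα (Metric.ball_subset_ball hσ2 hασ)
    β hβ (Metric.ball_subset_ball hσ2 hβσ)
  refine ⟨t, hrB ht, htρ, fun s _ hs => ?_⟩
  have hsr : s ∈ Metric.ball (0 : ℂ) r := by
    rw [mem_ball_iff_norm] at hs
    rw [mem_ball_zero_iff]
    linarith [norm_le_norm_add_norm_sub' s t₀]
  have h1 := ((hgap ε (hε.trans_le (min_le_left _ _)) α hα
    (Metric.ball_subset_ball (min_le_left _ _) hασ) β hβ
    (Metric.ball_subset_ball (min_le_left _ _) hβσ)).2 t ht).2.2.2 s hsr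
  have hC0 : 0 < C := by linarith
  rw [pow_one]
  calc min σ₁ (σ₂ / C) * ‖ε‖ ≤ σ₂ / C * ‖ε‖ := by gcongr; exact min_le_right _ _
    _ = σ₂ * ‖ε‖ / C := by ring
    _ ≤ _ := by rw [div_le_iff₀ hC0, mul_comm _ C]; exact hle.trans h1

end FlowBox

/-! ### Transport of separation between boxes and along plaques. -/

namespace FlowBox

variable {B B' : FlowBox} {X : Set (CP1 × CP1)} {lip : Prop}

/-- Separation does not depend on the flow box. -/
theorem IsSeparated.of_pt_eq (hB : B.IsChartOf X) (hB' : B'.IsChartOf X) (hc : B.Compatible B')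
    {α₀ t₀ α₀' t₀' : ℂ} (hα₀ : α₀ ∈ B.trans) (ht₀ : t₀ ∈ Metric.ball (0 : ℂ) B.radius)
    (hα₀' : α₀' ∈ B'.trans) (ht₀' : t₀' ∈ Metric.ball (0 : ℂ) B'.radius)
    (h : B.pt α₀ t₀ = B'.pt α₀' t₀') (hsep : B.IsSeparated lip α₀ t₀) :
    B'.IsSeparated lip α₀' t₀' := by
  obtain ⟨R, hR, hsep⟩ := hsep
  -- Three transitions: `Ha` carries all competing points into the R-disk of `B`, `Hb` carries the
  -- separating point back into the ρ'-disk of `B'`, and `Hc` keeps the indices in `B` within σ.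
  obtain ⟨ρa, hρa, Ha⟩ := hB'.exists_transition hB hc.symm hα₀' ht₀' hα₀ ht₀ h.symm hR
  refine ⟨ρa, hρa, fun ρ' hρ' => ?_⟩
  obtain ⟨ρb, hρb, Hb⟩ := hB.exists_transition hB' hc hα₀ ht₀ hα₀' ht₀' h hρ'
  obtain ⟨σ, hσ, κ, hκ, hκlip, H⟩ := hsep ρb hρb
  obtain ⟨ρc, hρc, Hc⟩ := hB'.exists_transition hB hc.symm hα₀' ht₀' hα₀ ht₀ h.symm (lt_min hσ hρb)
  refine ⟨min σ (min ρa ρc), by positivity, κ, hκ, hκlip, ?_⟩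
  set σ' := min σ (min ρa ρc)
  have h1 : σ' ≤ σ := min_le_left _ _
  have h2 : σ' ≤ ρa := (min_le_right _ _).trans (min_le_left _ _)
  have h3 : σ' ≤ ρc := (min_le_right _ _).trans (min_le_right _ _)
  intro ε hε0 hε α' hα' hα'σ β' hβ' hβ'σ
  obtain ⟨α, hα, hασ, Hα⟩ := Hc α' hα' (Metric.ball_subset_ball h3 hα'σ)
  obtain ⟨β, hβ, hβσ, Hβ⟩ := Hc β' hβ' (Metric.ball_subset_ball h3 hβ'σ)
  obtain ⟨βa, hβa, -, Hβa⟩ := Ha β' hβ' (Metric.ball_subset_ball h2 hβ'σ)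
  obtain ⟨αb, hαb, -, Hαb⟩ := Hb α hα (Metric.ball_subset_ball (min_le_right _ _) hασ)
  -- The plaques obtained from different transitions share a point and hence an index.
  have hβeq : βa = β := by
    obtain ⟨s₁, hs₁, -, e₁⟩ := Hβa t₀' ht₀' (Metric.mem_ball_self hρa)
    obtain ⟨s₂, hs₂, -, e₂⟩ := Hβ t₀' ht₀' (Metric.mem_ball_self hρc)
    exact (hB.pt_inj hβa hβ hs₁ hs₂ (e₁.symm.trans e₂)).1
  have hαeq : αb = α' := by
    obtain ⟨s₁, hs₁, hs₁σ, e₁⟩ := Hα t₀' ht₀' (Metric.mem_ball_self hρc)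
    obtain ⟨s₂, hs₂, -, e₂⟩ := Hαb s₁ hs₁ (Metric.ball_subset_ball (min_le_right _ _) hs₁σ)
    exact (hB'.pt_inj hαb hα' hs₂ ht₀' (e₂.symm.trans e₁.symm)).1
  subst hβeq hαeq
  obtain ⟨t, ht, htρ, hle⟩ := H ε hε0 (hε.trans_le h1) α hα
    (Metric.ball_subset_ball (min_le_left _ _) hασ) βa hβ
    (Metric.ball_subset_ball (min_le_left _ _) hβσ)
  obtain ⟨t', ht', ht'ρ, e⟩ := Hαb t ht htρ
  refine ⟨t', ht', ht'ρ, fun s' hs' hs'R => ?_⟩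
  obtain ⟨s, hs, hsR, e'⟩ := Hβa s' hs' hs'R
  rw [← e, e']
  exact le_trans (by gcongr) (hle s hs hsR)

/-- A priori bound of the gap; in the Lipschitz case it is of the order of `ε` as soon as it is so
at one point. -/
theorem IsChartOf.exists_norm_gap_le (hB : B.IsChartOf X) {e : ℕ}
    (he : (lip ∧ e = 1) ∨ (¬ lip ∧ e = 0)) (hlip : lip → B.IsLipschitz) {α₀ : ℂ}
    (hα₀ : α₀ ∈ B.trans) {r : ℝ} (hr : r < B.radius) :
    ∃ M > 0, ∃ σ > 0, ∀ ε : ℂ, ‖ε‖ < σ → ∀ α ∈ B.trans, α ∈ Metric.ball α₀ σ →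
      ∀ β ∈ B.trans, β ∈ Metric.ball α₀ σ →
      (∃ t ∈ Metric.ball (0 : ℂ) r, ‖B.gap ε α β t‖ ≤ ‖ε‖) →
      ∀ t ∈ Metric.ball (0 : ℂ) r, ‖B.gap ε α β t‖ ≤ M * ‖ε‖ ^ e := by
  obtain ⟨C, hC, σ, hσ, H⟩ := hB.exists_gap_bounds hα₀ hr
  rcases he with ⟨hl, rfl⟩ | ⟨-, rfl⟩
  · obtain ⟨D, hD, HD⟩ := hlip hl
    refine ⟨D * (D * (1 + C)) + C, by positivity, σ, hσ, ?_⟩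
    rintro ε hε α hα hασ β hβ hβσ ⟨t, ht, hsmall⟩ s hs
    have hrB : Metric.ball (0 : ℂ) r ⊆ Metric.ball 0 B.radius := Metric.ball_subset_ball hr.le
    have h1 := ((H ε hε α hα hασ β hβ hβσ).2 t ht).2.1
    have h2 := ((H ε hε α hα hασ β hβ hβσ).2 s hs).2.1
    have h3 := (HD α hα β hβ t (hrB ht)).1
    have h4 := (HD α hα β hβ s (hrB hs)).2
    change ‖α - β‖ / D ≤ ‖B.height α t - B.height β t‖ at h3
    change ‖B.height α s - B.height β s‖ ≤ D * ‖α - β‖ at h4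
    rw [div_le_iff₀ hD] at h3
    have h5 : ‖B.height α t - B.height β t‖ ≤ (1 + C) * ‖ε‖ := by
      rw [norm_sub_rev] at h1
      linarith [norm_le_norm_add_norm_sub' (B.height α t - B.height β t) (B.gap ε α β t)]
    -- A gap of at most |ε| at one point makes the heights O(|ε|)-close there, hence the indices,
    -- hence the heights over the whole disk.
    have h6 : ‖α - β‖ ≤ (1 + C) * ‖ε‖ * D := h3.trans (by gcongr)
    have h7 : D * ‖α - β‖ ≤ D * ((1 + C) * ‖ε‖ * D) := by gcongr
    have h8 := norm_le_norm_add_norm_sub' (B.gap ε α β s) (B.height α s - B.height β s)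
    rw [pow_one]
    linarith
  · refine ⟨C, by linarith, σ, hσ, ?_⟩
    intro ε hε α hα hασ β hβ hβσ _ s hs
    simpa using ((H ε hε α hα hασ β hβ hβσ).2 s hs).1

/-- Separation propagates along the plaques. -/
theorem IsSeparated.of_mem_plaque (hB : B.IsChartOf X) (hlip : lip → B.IsLipschitz)
    {α₀ t₀ t₁ : ℂ} (hα₀ : α₀ ∈ B.trans) (ht₀ : t₀ ∈ Metric.ball (0 : ℂ) B.radius)
    (ht₁ : t₁ ∈ Metric.ball (0 : ℂ) B.radius) (hsep : B.IsSeparated lip α₀ t₀) :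
    B.IsSeparated lip α₀ t₁ := by
  -- The exponent in the a priori bound M|ε|^e of the gap.
  obtain ⟨e, he⟩ : ∃ e : ℕ, (lip ∧ e = 1) ∨ (¬ lip ∧ e = 0) := by
    by_cases h : lip
    · exact ⟨1, .inl ⟨h, rfl⟩⟩
    · exact ⟨0, .inr ⟨h, rfl⟩⟩
  obtain ⟨r, hr1, hr⟩ := exists_between
    (max_lt (mem_ball_zero_iff.1 ht₀) (mem_ball_zero_iff.1 ht₁))
  obtain ⟨h0r, h1r⟩ := max_lt_iff.1 hr1
  have hrB : Metric.ball (0 : ℂ) r ⊆ Metric.ball 0 B.radius := Metric.ball_subset_ball hr.le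
  obtain ⟨C, hC, σ₁, hσ₁, Hgap⟩ := hB.exists_gap_bounds hα₀ hr
  obtain ⟨M, hM, σ₂, hσ₂, Hap⟩ := hB.exists_norm_gap_le he hlip hα₀ hr
  obtain ⟨R, hR, hsep⟩ := hsep
  have hin : ∀ c s : ℂ, s ∈ Metric.ball c (r - ‖c‖) → s ∈ Metric.ball (0 : ℂ) r := by
    intro c s hs
    rw [mem_ball_iff_norm] at hs
    rw [mem_ball_zero_iff]
    linarith [norm_le_norm_add_norm_sub' s c]
  refine ⟨r - ‖t₁‖, by linarith, fun ρ hρ => ?_⟩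
  obtain ⟨ρ', hρ', N, hN, Hprop⟩ := smallnessPropagates (x := t₁) (y := t₀)
    (mem_ball_zero_iff.2 h1r) (mem_ball_zero_iff.2 h0r) ρ hρ
  obtain ⟨σ₀, hσ₀, κ₀, hκ₀, hκ₀lip, H⟩ := hsep (min ρ' (min (R / 2) (r - ‖t₀‖)))
    (lt_min hρ' (lt_min (by positivity) (by linarith)))
  -- Propagation yields |ε|^(κ₀N) against |ε|^(κ + e(N-1)). With e = κ₀ = 1 the choice κ = 1
  -- suffices; with e = 0 one takes κ = κ₀N.
  obtain ⟨κ, hκ, hκlip, hκle⟩ : ∃ κ : ℕ, 1 ≤ κ ∧ (lip → κ = 1) ∧ κ₀ * N ≤ κ + e * (N - 1) := by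
    rcases he with ⟨hl, rfl⟩ | ⟨hl, rfl⟩
    · refine ⟨1, le_rfl, fun _ => rfl, ?_⟩
      rw [hκ₀lip hl]; omega
    · exact ⟨κ₀ * N, Nat.mul_pos hκ₀ hN, fun h => absurd h hl, by simp⟩
  have hC0 : 0 < C := by linarith
  refine ⟨min (min σ₀ (min σ₁ σ₂)) (min (R / (2 * C)) (min (1 / C) (σ₀ ^ N / (2 * C * M ^ (N - 1))))),
    by positivity, κ, hκ, hκlip, ?_⟩
  set σ := min (min σ₀ (min σ₁ σ₂))
    (min (R / (2 * C)) (min (1 / C) (σ₀ ^ N / (2 * C * M ^ (N - 1))))) with hσ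
  have hσpos : 0 < σ := by positivity
  have k0 : σ ≤ σ₀ := (min_le_left _ _).trans (min_le_left _ _)
  have k1 : σ ≤ σ₁ := (min_le_left _ _).trans ((min_le_right _ _).trans (min_le_left _ _))
  have k2 : σ ≤ σ₂ := (min_le_left _ _).trans ((min_le_right _ _).trans (min_le_right _ _))
  have k3 : σ ≤ R / (2 * C) := (min_le_right _ _).trans (min_le_left _ _)
  have k4 : σ ≤ 1 / C := (min_le_right _ _).trans ((min_le_right _ _).trans (min_le_left _ _))
  have k5 : σ ≤ σ₀ ^ N / (2 * C * M ^ (N - 1)) :=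
    (min_le_right _ _).trans ((min_le_right _ _).trans (min_le_right _ _))
  intro ε hε0 hε α hα hασ β hβ hβσ
  by_contra! hcon
  have hball : ∀ {γ σ' : ℂ} {τ : ℝ}, σ ≤ τ → γ ∈ Metric.ball σ' σ → γ ∈ Metric.ball σ' τ :=
    fun h hγ => Metric.ball_subset_ball h hγ
  have hCσ : C * σ ≤ 1 := by rw [le_div_iff₀ hC0] at k4; linarith
  have hε1 : ‖ε‖ ≤ 1 := by
    have : 1 / C ≤ 1 := by rw [div_le_one hC0]; exact hC
    linarith
  obtain ⟨hgd, Hgap⟩ := Hgap ε (hε.trans_le k1) α hα (hball k1 hασ) β hβ (hball k1 hβσ)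
  have hsmall : ∀ t ∈ Metric.ball (0 : ℂ) r, t ∈ Metric.ball t₁ ρ →
      ‖B.gap ε α β t‖ ≤ C * (σ * ‖ε‖ ^ κ) := by
    intro t ht htρ
    obtain ⟨s, hs, hsR, hlt⟩ := hcon t (hrB ht) htρ
    refine ((Hgap t ht).2.2.2 s (hin t₁ s hsR)).trans ?_
    gcongr
  -- Smallness at `t₁` itself, from Cσ ≤ 1 and κ ≥ 1, triggers the a priori bound.
  have hap := Hap ε (hε.trans_le k2) α hα (hball k2 hασ) β hβ (hball k2 hβσ)
    ⟨t₁, mem_ball_zero_iff.2 h1r, by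
      refine (hsmall t₁ (mem_ball_zero_iff.2 h1r) (Metric.mem_ball_self hρ)).trans ?_
      rw [← mul_assoc]
      calc C * σ * ‖ε‖ ^ κ ≤ 1 * ‖ε‖ ^ 1 :=
            mul_le_mul hCσ (pow_le_pow_of_le_one hε0.le hε1 hκ) (by positivity) zero_le_one
        _ = ‖ε‖ := by simp⟩
  have hpr := Hprop (B.gap ε α β) _ _ hgd hap hsmall
  obtain ⟨t, ht, htρ, hle⟩ := H ε hε0 (hε.trans_le k0) α hα (hball k0 hασ) β hβ (hball k0 hβσ)
  have htr : t ∈ Metric.ball (0 : ℂ) r := hin t₀ t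
    (Metric.ball_subset_ball ((min_le_right _ _).trans (min_le_right _ _)) htρ)
  have h1 := hpr t htr (Metric.ball_subset_ball (min_le_left _ _) htρ)
  obtain ⟨s, hs, hst, hle2⟩ := (Hgap t htr).2.2.1
  have hsR : s ∈ Metric.ball t₀ R := by
    have h2 : dist t t₀ < R / 2 :=
      lt_of_lt_of_le htρ ((min_le_right _ _).trans (min_le_left _ _))
    have h3 : C * ‖ε‖ < R / 2 := by
      have h4 := hε.trans_le k3
      rw [lt_div_iff₀ (by positivity)] at h4
      linarith
    rw [← dist_eq_norm] at hst
    rw [Metric.mem_ball]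
    linarith [dist_triangle s t t₀]
  have h2 := (hle s hs hsR).trans hle2
  have h3 : (σ₀ * ‖ε‖ ^ κ₀) ^ N ≤ C * (σ * ‖ε‖ ^ κ) * (M * ‖ε‖ ^ e) ^ (N - 1) :=
    (pow_le_pow_left₀ (by positivity) h2 N).trans h1
  rw [mul_pow, mul_pow, ← pow_mul, ← pow_mul] at h3
  have h4 : ‖ε‖ ^ (κ + e * (N - 1)) ≤ ‖ε‖ ^ (κ₀ * N) := pow_le_pow_of_le_one hε0.le hε1 hκle
  -- The factor 2 in the last term of σ turns the comparison into a positive number bounded by its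
  -- own half.
  have h5 : C * σ * M ^ (N - 1) ≤ σ₀ ^ N / 2 := by
    rw [le_div_iff₀ (by positivity)] at k5
    linarith
  have h6 : σ₀ ^ N * ‖ε‖ ^ (κ₀ * N) ≤ σ₀ ^ N / 2 * ‖ε‖ ^ (κ₀ * N) := by
    calc σ₀ ^ N * ‖ε‖ ^ (κ₀ * N) ≤ C * σ * M ^ (N - 1) * ‖ε‖ ^ (κ + e * (N - 1)) := by
          refine h3.trans_eq ?_
          rw [pow_add]; ring
      _ ≤ σ₀ ^ N / 2 * ‖ε‖ ^ (κ₀ * N) := by gcongr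
  have h7 : 0 < σ₀ ^ N * ‖ε‖ ^ (κ₀ * N) := by positivity
  linarith

end FlowBox

/-! ### Separation at every point of the lamination. -/

namespace Lamination

variable {L : Lamination} {lip : Prop}

/-- Separation near a point of the lamination, in all flow boxes. -/
def IsSeparatedAt (L : Lamination) (lip : Prop) (x : CP1 × CP1) : Prop :=
  ∀ B, L.IsFlowBox B → ∀ α ∈ B.trans, ∀ t ∈ Metric.ball (0 : ℂ) B.radius, B.pt α t = x →
    B.IsSeparated lip α t

theorem IsFlowBox.isSeparatedAt {B : FlowBox} (hB : L.IsFlowBox B) {α t : ℂ} (hα : α ∈ B.trans)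
    (ht : t ∈ Metric.ball (0 : ℂ) B.radius) (h : B.IsSeparated lip α t) :
    L.IsSeparatedAt lip (B.pt α t) := fun _ hB' _ hα' _ ht' he =>
  h.of_pt_eq hB.1 hB'.1 (hB.compatible hB') hα ht hα' ht' he.symm

theorem exists_good_flowBox (hlip : lip → L.IsLipschitz) {x : CP1 × CP1} (hx : x ∈ L.carrier) :
    ∃ B, L.IsFlowBox B ∧ (lip → B.IsLipschitz) ∧
      ∃ α ∈ B.trans, ∃ t ∈ Metric.ball (0 : ℂ) B.radius, B.pt α t = x := by
  by_cases h : lip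
  · obtain ⟨B, hB, hxB, hBl⟩ := hlip h x hx
    exact ⟨B, hB, fun _ => hBl, FlowBox.mem_support_iff.1 hxB⟩
  · obtain ⟨B, hB, hxB⟩ := L.exists_atlas hx
    exact ⟨B, isFlowBox_of_mem_atlas hB, fun h' => absurd h' h, hxB⟩

/-- The given box need not be Lipschitz. Each point of the plaque has a neighbourhood in the plaque
lying in one plaque of a good box, where separation propagates; connectedness of the disk links the
neighbourhoods. -/
theorem IsFlowBox.isSeparatedAt_of_plaque (hlip : lip → L.IsLipschitz) {B : FlowBox}
    (hB : L.IsFlowBox B) {α t₀ t₁ : ℂ} (hα : α ∈ B.trans)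
    (ht₀ : t₀ ∈ Metric.ball (0 : ℂ) B.radius) (ht₁ : t₁ ∈ Metric.ball (0 : ℂ) B.radius) :
    L.IsSeparatedAt lip (B.pt α t₀) → L.IsSeparatedAt lip (B.pt α t₁) := by
  refine (convex_ball (0 : ℂ) B.radius).isPreconnected.induction₂'
    (fun x y => L.IsSeparatedAt lip (B.pt α x) → L.IsSeparatedAt lip (B.pt α y)) ?_
    (fun x y z _ _ _ h1 h2 h => h2 (h1 h)) ht₀ ht₁
  intro z hz
  obtain ⟨G, hG, hGl, γ, hγ, u, hu, hzu⟩ := L.exists_good_flowBox hlip (hB.1.pt_mem hα hz)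
  obtain ⟨ρ, hρ, H⟩ := hB.1.exists_transition hG.1 (hB.compatible hG) hα hz hγ hu hzu.symm one_pos
  obtain ⟨γ', hγ', -, H⟩ := H α hα (Metric.mem_ball_self hρ)
  obtain ⟨z', hz', -, ez⟩ := H z hz (Metric.mem_ball_self hρ)
  filter_upwards [self_mem_nhdsWithin, mem_nhdsWithin_of_mem_nhds (Metric.ball_mem_nhds z hρ)]
    with w hw hwρ
  obtain ⟨w', hw', -, ew⟩ := H w hw hwρ
  rw [ez, ew]
  exact ⟨fun h => hG.isSeparatedAt hγ' hw'
      ((h G hG γ' hγ' z' hz' rfl).of_mem_plaque hG.1 hGl hγ' hz' hw'),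
    fun h => hG.isSeparatedAt hγ' hz'
      ((h G hG γ' hγ' w' hw' rfl).of_mem_plaque hG.1 hGl hγ' hw' hz')⟩

/-- The leaf reaches the fibre over infinity, where separation holds; it is carried back along the
chain of plaques. -/
theorem HasNoCompactLeaves.isSeparatedAt (hL : L.HasNoCompactLeaves) (hlip : lip → L.IsLipschitz)
    {x : CP1 × CP1} (hx : x ∈ L.carrier) : L.IsSeparatedAt lip x := by
  obtain ⟨y, hy, hy1⟩ := hL.exists_mem_leaf_fst_eq hx
  have hback : L.IsSeparatedAt lip y → L.IsSeparatedAt lip x := by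
    clear hy1
    induction hy with
    | refl => exact id
    | tail _ hstep ih =>
      obtain ⟨B, hB, α, hα, ⟨t, ht, rfl⟩, s, hs, rfl⟩ := hstep
      exact fun h =>
        ih ((isFlowBox_of_mem_atlas hB).isSeparatedAt_of_plaque hlip hα hs ht h)
  refine hback ?_
  obtain ⟨B, hB, α, hα, t, ht, rfl⟩ := L.exists_atlas (leaf_subset_carrier hx hy)
  exact (isFlowBox_of_mem_atlas hB).isSeparatedAt hα ht
    (FlowBox.isSeparated_of_fst_eq_infinity hL hB hα ht hy1 lip)

end Lamination

/-! ### Counting intersections. -/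

theorem Set.finite_and_ncard_le_of_forall_finset {γ : Type*} {Z : Set γ} {b : ℝ}
    (h : ∀ S : Finset γ, ↑S ⊆ Z → (S.card : ℝ) ≤ b) : Z.Finite ∧ (Z.ncard : ℝ) ≤ b := by
  have hfin : Z.Finite := by
    by_contra hinf
    obtain ⟨n, hn⟩ := exists_nat_gt b
    obtain ⟨S, hS, hcard⟩ := Set.Infinite.exists_subset_card_eq hinf n
    have := h S hS
    rw [hcard] at this
    linarith
  refine ⟨hfin, ?_⟩
  rw [Set.ncard_eq_toFinset_card Z hfin]
  exact h _ (by simp)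

/-- The logarithmic form of the comparison of separation with the smallness forced by zeros. -/
theorem natCast_le_of_mul_pow_le {σ M c x : ℝ} {κ e n : ℕ} (hσ : 0 < σ) (hM : 0 < M) (hc : 0 < c)
    (hc1 : c < 1) (hx : 0 < x) (h : σ * x ^ κ ≤ M * x ^ e * c ^ n) :
    (n : ℝ) ≤ (Real.log (M / σ) + ((κ : ℝ) - e) * Real.log (1 / x)) / Real.log (1 / c) := by
  have hq : 0 < Real.log (1 / c) := Real.log_pos (by rw [lt_div_iff₀ hc]; linarith)
  rw [le_div_iff₀ hq]
  have h1 := Real.log_le_log (by positivity) h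
  rw [Real.log_mul (by positivity) (by positivity), Real.log_mul (by positivity) (by positivity),
    Real.log_mul (by positivity) (by positivity), Real.log_pow, Real.log_pow, Real.log_pow] at h1
  rw [Real.log_div hM.ne' hσ.ne', one_div, one_div, Real.log_inv, Real.log_inv]
  linarith

namespace Lamination

variable {L : Lamination} {lip : Prop}

/-- Bounds, for `0 < ‖ε‖ < ε₀`, for the
number of intersections of the plaques with the images of the plaques under `Phi ε`. -/
def HasIntersectionBound (lip : Prop) (B : FlowBox) (ε₀ A : ℝ) : Prop :=
  ∀ α ∈ B.trans, ∀ β ∈ B.trans, ∀ ε : ℂ, 0 < ‖ε‖ → ‖ε‖ < ε₀ →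
    (B.plaque α ∩ Phi ε '' B.plaque β).Finite ∧
      (lip → ((B.plaque α ∩ Phi ε '' B.plaque β).ncard : ℝ) < A) ∧
      ((B.plaque α ∩ Phi ε '' B.plaque β).ncard : ℝ) < A * Real.log (1 / ‖ε‖)

theorem HasIntersectionBound.mono {B : FlowBox} {ε₀ ε₁ A A' : ℝ}
    (h : HasIntersectionBound lip B ε₀ A) (hε : ε₁ ≤ ε₀) (hε1 : ε₁ ≤ 1) (hA : A ≤ A') :
    HasIntersectionBound lip B ε₁ A' := by
  intro α hα β hβ ε h0 h1
  obtain ⟨h2, h3, h4⟩ := h α hα β hβ ε h0 (h1.trans_le hε)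
  refine ⟨h2, fun hl => (h3 hl).trans_le hA, h4.trans_le ?_⟩
  have : 0 ≤ Real.log (1 / ‖ε‖) := Real.log_nonneg (by rw [le_div_iff₀ h0]; linarith)
  gcongr

/-- Intersections inject into the zeros of the gap. Many zeros make the gap small on the disk of
radius r₁, while separation at the center of the disk bounds it from below at some point of that
disk. -/
theorem HasNoCompactLeaves.exists_flowBox_hasIntersectionBound (hL : L.HasNoCompactLeaves)
    (hlip : lip → L.IsLipschitz) {x : CP1 × CP1} (hx : x ∈ L.carrier) :
    ∃ B, L.IsFlowBox B ∧ x ∈ B.support ∧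
      ∃ ε₀ > 0, ∃ A > 0, ε₀ ≤ 1 ∧ HasIntersectionBound lip B ε₀ A := by
  obtain ⟨B, hB, hBlip, α₀, hα₀, t₀, ht₀, rfl⟩ := L.exists_good_flowBox hlip hx
  obtain ⟨e, he⟩ : ∃ e : ℕ, (lip ∧ e = 1) ∨ (¬ lip ∧ e = 0) := by
    by_cases h : lip
    · exact ⟨1, .inl ⟨h, rfl⟩⟩
    · exact ⟨0, .inr ⟨h, rfl⟩⟩
  have h0 : (0 : ℂ) ∈ Metric.ball (0 : ℂ) B.radius := Metric.mem_ball_self B.radius_pos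
  obtain ⟨R, hR, hsep⟩ := hL.isSeparatedAt hlip (hB.1.pt_mem hα₀ h0) B hB α₀ hα₀ 0 h0 rfl
  obtain ⟨r₁, hr₁, ht₀r₁, hr₁B⟩ := exists_norm_le_lt_of_mem_ball ht₀
  obtain ⟨r₂, hr₁₂, hr₂⟩ := exists_between hr₁B
  have hball₁ : Metric.ball (0 : ℂ) r₁ ⊆ Metric.ball 0 r₂ := Metric.ball_subset_ball hr₁₂.le
  obtain ⟨C, hC, σ₁, hσ₁, Hgap⟩ := hB.1.exists_gap_bounds hα₀ hr₂
  obtain ⟨M, hM, σ₂, hσ₂, Hap⟩ := hB.1.exists_norm_gap_le he hBlip hα₀ hr₂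
  obtain ⟨c, hc, hc1, Hzero⟩ := exists_norm_le_mul_pow_card_zeros hr₁ hr₁₂
  -- The separating point t lies in the disk where zeros force smallness; being within R/2 of 0, it
  -- leaves room for its companion s, at distance at most C|ε|, in the disk of radius R.
  obtain ⟨σ₀, hσ₀, κ, hκ, hκlip, H⟩ := hsep (min (R / 2) r₁) (by positivity)
  have hC0 : 0 < C := by linarith
  have hq : 0 < Real.log (1 / c) := Real.log_pos (by rw [lt_div_iff₀ hc]; linarith)
  set σ := min σ₀ (min σ₁ σ₂) with hσ
  have hσpos : 0 < σ := by positivity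
  have k0 : σ ≤ σ₀ := min_le_left _ _
  have k1 : σ ≤ σ₁ := (min_le_right _ _).trans (min_le_left _ _)
  have k2 : σ ≤ σ₂ := (min_le_right _ _).trans (min_le_right _ _)
  -- The added 1 makes both final inequalities strict; the bound exp(-1) on |ε| below gives
  -- log(1/|ε|) ≥ 1, which absorbs the constant term.
  set A : ℝ := (|Real.log (M / σ₀)| + κ) / Real.log (1 / c) + 1 with hA
  refine ⟨B.restrict α₀ hα₀ σ hσpos r₁ hr₁ hr₁B.le, ⟨hB.1.restrict, fun B' hB' =>
    (hB.2 B' hB').restrict hB.1⟩, ?_, min σ (min (R / (2 * C)) (Real.exp (-1))), by positivity,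
    A, by positivity, ?_, ?_⟩
  · refine FlowBox.mem_support_iff.2 ⟨0, FlowBox.zero_mem_trans _, t₀, by
      simpa [FlowBox.restrict] using ht₀r₁, ?_⟩
    rw [FlowBox.restrict_pt, add_zero]
  · exact (min_le_right _ _).trans ((min_le_right _ _).trans (Real.exp_le_one_iff.2 (by norm_num)))
  rintro a ⟨hα, haσ⟩ b ⟨hβ, hbσ⟩ ε hε0 hε
  simp only [lt_min_iff] at hε
  obtain ⟨hεσ, hεR, hεexp⟩ := hε
  set α := α₀ + a with hαdef
  set β := α₀ + b with hβdef
  have hασ : ∀ {τ : ℝ}, σ ≤ τ → α ∈ Metric.ball α₀ τ := fun h => by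
    simpa [hαdef] using haσ.trans_le h
  have hβσ : ∀ {τ : ℝ}, σ ≤ τ → β ∈ Metric.ball α₀ τ := fun h => by
    simpa [hβdef] using hbσ.trans_le h
  obtain ⟨hgd, Hgap⟩ := Hgap ε (hεσ.trans_le k1) α hα (hασ k1) β hβ (hβσ k1)
  have hlog : 1 ≤ Real.log (1 / ‖ε‖) := by
    rw [one_div, Real.log_inv, le_neg]
    exact ((Real.log_lt_iff_lt_exp hε0).2 hεexp).le
  set Z : Set ℂ := {t | t ∈ Metric.ball (0 : ℂ) r₁ ∧ B.gap ε α β t = 0} with hZ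
  have hsub : (B.restrict α₀ hα₀ σ hσpos r₁ hr₁ hr₁B.le).plaque a ∩
      Phi ε '' (B.restrict α₀ hα₀ σ hσpos r₁ hr₁ hr₁B.le).plaque b ⊆ B.pt α '' Z := by
    rintro _ ⟨⟨t, ht, rfl⟩, _, ⟨s, hs, rfl⟩, hst⟩
    rw [FlowBox.restrict_pt, FlowBox.restrict_pt] at hst
    rw [FlowBox.restrict_pt]
    refine ⟨t, ⟨ht, ?_⟩, rfl⟩
    have h1 := (Hgap t (hball₁ ht)).2.2.2 s (hball₁ hs)
    rw [hst, chordSum_self, mul_zero, norm_le_zero_iff] at h1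
    exact h1
  obtain ⟨hZfin, hZcard⟩ := Set.finite_and_ncard_le_of_forall_finset (Z := Z)
    (b := (|Real.log (M / σ₀)| + ((κ : ℝ) - e) * Real.log (1 / ‖ε‖)) / Real.log (1 / c)) (by
    intro S hS
    have hκe : (e : ℝ) ≤ κ := by
      rcases he with ⟨-, rfl⟩ | ⟨-, rfl⟩
      · exact_mod_cast hκ
      · simp
    rcases S.eq_empty_or_nonempty with rfl | ⟨z, hz⟩
    -- The empty case is separate because the a priori bound of the gap needs a point where it is at
    -- most |ε|, here a zero.
    · simp only [Finset.card_empty, Nat.cast_zero]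
      have : 0 ≤ ((κ : ℝ) - e) * Real.log (1 / ‖ε‖) :=
        mul_nonneg (by linarith) (by linarith)
      positivity
    have hap := Hap ε (hεσ.trans_le k2) α hα (hασ k2) β hβ (hβσ k2)
      ⟨z, hball₁ (hS hz).1, by rw [(hS hz).2, norm_zero]; exact hε0.le⟩
    have hzero := Hzero S (B.gap ε α β) _ hgd hap
      (fun w hw => ⟨mem_ball_zero_iff.1 (hS hw).1, (hS hw).2⟩)
    obtain ⟨t, -, htρ, hle⟩ := H ε hε0 (hεσ.trans_le k0) α hα (hασ k0) β hβ (hβσ k0)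
    have htr₁ : t ∈ Metric.ball (0 : ℂ) r₁ := Metric.ball_subset_ball (min_le_right _ _) htρ
    obtain ⟨s, hs, hst, hle2⟩ := (Hgap t (hball₁ htr₁)).2.2.1
    have hsR : s ∈ Metric.ball (0 : ℂ) R := by
      have h2 : ‖t‖ < R / 2 := mem_ball_zero_iff.1 (Metric.ball_subset_ball (min_le_left _ _) htρ)
      rw [lt_div_iff₀ (by positivity)] at hεR
      rw [mem_ball_zero_iff]
      linarith [norm_le_norm_add_norm_sub' s t]
    have h3 := ((hle s hs hsR).trans hle2).trans (hzero t htr₁)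
    refine (natCast_le_of_mul_pow_le hσ₀ hM hc hc1 hε0 h3).trans ?_
    gcongr
    exact le_abs_self _)
  have hle : (((B.restrict α₀ hα₀ σ hσpos r₁ hr₁ hr₁B.le).plaque a ∩
      Phi ε '' (B.restrict α₀ hα₀ σ hσpos r₁ hr₁ hr₁B.le).plaque b).ncard : ℝ) ≤ Z.ncard := by
    exact_mod_cast (Set.ncard_le_ncard hsub (hZfin.image _)).trans (Set.ncard_image_le hZfin)
  refine ⟨(hZfin.image _).subset hsub, fun hl => ?_, ?_⟩
  · refine (hle.trans hZcard).trans_lt ?_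
    have he1 : e = 1 := by
      rcases he with ⟨-, rfl⟩ | ⟨h, -⟩
      · rfl
      · exact absurd hl h
    rw [hκlip hl, he1, sub_self, zero_mul, add_zero, hA]
    refine lt_of_le_of_lt ?_ (lt_add_one _)
    gcongr
    simp
  · refine (hle.trans hZcard).trans_lt ?_
    calc (|Real.log (M / σ₀)| + ((κ : ℝ) - e) * Real.log (1 / ‖ε‖)) / Real.log (1 / c)
        ≤ (|Real.log (M / σ₀)| * Real.log (1 / ‖ε‖) + κ * Real.log (1 / ‖ε‖)) /
          Real.log (1 / c) := by
          gcongr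
          · exact le_mul_of_one_le_right (abs_nonneg _) hlog
          · simp
      _ = (A - 1) * Real.log (1 / ‖ε‖) := by rw [hA]; ring
      _ < A * Real.log (1 / ‖ε‖) := by nlinarith

theorem isCompact_carrier (L : Lamination) : IsCompact L.carrier := L.isClosed_carrier.isCompact

theorem IsFlowBox.support_mem_nhdsWithin {B : FlowBox} (hB : L.IsFlowBox B) {x : CP1 × CP1}
    (hx : x ∈ B.support) : B.support ∈ 𝓝[L.carrier] x := by
  obtain ⟨-, O, hO, h⟩ := hB.1
  rw [h] at hx ⊢
  exact Filter.inter_mem (mem_nhdsWithin_of_mem_nhds (hO.mem_nhds hx.1)) self_mem_nhdsWithin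

theorem HasNoCompactLeaves.exists_cover (hL : L.HasNoCompactLeaves) (hlip : lip → L.IsLipschitz) :
    ∃ (𝓑 : Set FlowBox) (ε₀ A : ℝ), (∀ B ∈ 𝓑, L.IsFlowBox B) ∧ L.carrier ⊆ ⋃ B ∈ 𝓑, B.support ∧
      0 < ε₀ ∧ ε₀ ≤ 1 ∧ 0 < A ∧ ∀ B ∈ 𝓑, HasIntersectionBound lip B ε₀ A := by
  -- Subsets admitting a cover with common constants are stable under finite unions, by taking the
  -- smaller ε₀ and the larger A.
  refine L.isCompact_carrier.induction_on
    (p := fun s => ∃ (𝓑 : Set FlowBox) (ε₀ A : ℝ), (∀ B ∈ 𝓑, L.IsFlowBox B) ∧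
      s ⊆ ⋃ B ∈ 𝓑, B.support ∧ 0 < ε₀ ∧ ε₀ ≤ 1 ∧ 0 < A ∧
        ∀ B ∈ 𝓑, HasIntersectionBound lip B ε₀ A) ?_ ?_ ?_ ?_
  · exact ⟨∅, 1, 1, by simp, by simp, one_pos, le_rfl, one_pos, by simp⟩
  · rintro s t hst ⟨𝓑, ε₀, A, h1, h2, h3⟩
    exact ⟨𝓑, ε₀, A, h1, hst.trans h2, h3⟩
  · rintro s t ⟨𝓑, ε₀, A, h1, h2, h3, h4, h5, h6⟩ ⟨𝓑', ε₀', A', h1', h2', h3', h4', h5', h6'⟩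
    refine ⟨𝓑 ∪ 𝓑', min ε₀ ε₀', max A A', ?_, ?_, lt_min h3 h3', (min_le_left _ _).trans h4,
      lt_max_of_lt_left h5, ?_⟩
    · rintro B (hB | hB)
      exacts [h1 B hB, h1' B hB]
    · rw [biUnion_union]
      exact union_subset_union h2 h2'
    · rintro B (hB | hB)
      · exact (h6 B hB).mono (min_le_left _ _) ((min_le_left _ _).trans h4) (le_max_left _ _)
      · exact (h6' B hB).mono (min_le_right _ _) ((min_le_left _ _).trans h4) (le_max_right _ _)
  · intro x hx
    obtain ⟨B, hB, hxB, ε₀, hε₀, A, hA, hε1, hbd⟩ :=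
      hL.exists_flowBox_hasIntersectionBound hlip hx
    exact ⟨B.support, hB.support_mem_nhdsWithin hxB, {B}, ε₀, A, by simpa using hB, by simp,
      hε₀, hε1, hA, by simpa using hbd⟩

end Lamination

theorem mainTheorem7 (L : Lamination) (hL : L.HasNoCompactLeaves)
    (Y : Set (CP1 × CP1)) (hY : L.IsMinimalSet Y)
    (hunique : ∀ Z : Set (CP1 × CP1), L.IsMinimalSet Z → Z = Y)
    (p : CP1 × CP1) (hpY : p ∈ Y)
    (hph : ¬ L.IsHorizontalPoint p) (hpv : ¬ L.IsVerticalPoint p) :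
    ∃ (𝓑 : Set FlowBox) (ε₀ : ℝ) (N : ℕ) (A : ℝ),
      (∀ B ∈ 𝓑, L.IsFlowBox B) ∧ L.carrier ⊆ ⋃ B ∈ 𝓑, B.support ∧ 0 < ε₀ ∧ 0 < A ∧
      ∀ B ∈ 𝓑, ∀ α ∈ B.trans, ∀ β ∈ B.trans, ∀ ε : ℂ, 0 < ‖ε‖ → ‖ε‖ < ε₀ →
        (L.IsLipschitz →
          (B.plaque α ∩ Phi ε '' B.plaque β).Finite ∧
            (B.plaque α ∩ Phi ε '' B.plaque β).ncard < N) ∧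
        ((B.plaque α ∩ Phi ε '' B.plaque β).Finite ∧
          ((B.plaque α ∩ Phi ε '' B.plaque β).ncard : ℝ) < A * Real.log (1 / ‖ε‖)) := by
  -- With `lip` equal to the Lipschitz property itself, one cover serves both assertions, without
  -- splitting into cases.
  obtain ⟨𝓑, ε₀, A, h1, h2, h3, -, h5, h6⟩ := hL.exists_cover (lip := L.IsLipschitz) id
  refine ⟨𝓑, ε₀, ⌈A⌉₊, A, h1, h2, h3, h5, fun B hB α hα β hβ ε hε0 hε => ?_⟩
  obtain ⟨h7, h8, h9⟩ := h6 B hB α hα β hβ ε hε0 hε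
  exact ⟨fun hl => ⟨h7, by exact_mod_cast (h8 hl).trans_le (Nat.le_ceil A)⟩, h7, h9⟩
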